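/- Let $n\ge 1$. There is a constant $C_n>0$ depending only on $n$ with the following property. Let $M^n$ be a closed (compact, without boundary) smooth $n$-manifold, let $T>0$, and let $F:M^n\times[0,T]\to\mathbb R^{n+1}$ be a smooth closed star-shaped solution of the inverse mean curvature flow, that is, a smooth family of immersions $F(\cdot,t)$, $t\in[0,T]$, with smooth outward unit normal $\nu(p,t)$ and mean curvature $H(p,t)>0$ (the sum of the principal curvatures with respect to $\nu$, so that $H=n$ on the unit sphere), satisfying $$\frac{\partial F}{\partial t}(p,t)=\frac{1}{H(p,t)}\,\nu(p,t)\qquad\text{on } M^n\times[0,T].$$ Here star-shaped means that $\langle F,\nu\rangle>0$. Suppose that at time $t=0$, for some constants $R_1,R_2$, $$0<R_1\le\langle F,\nu\rangle\le R_2\qquad\text{on } M^n.$$ Then, for all $(p,t)\in M^n\times(0,T]$, $$\frac{1}{H(p,t)}\le C_n\,\frac{R_2}{R_1}\Bigl(1+\frac{1}{t^{1/2}}\Bigr)R_2\,e^{t/n}.$$ (At $t=0$ the right-hand side is $+\infty$ and there is nothing to prove.) -/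

import Mathlib

open Set
open scoped Manifold ContDiff

namespace IMCF

noncomputable section

/-- The coordinate derivative `∂f/∂xⁱ` at `p`, in the coordinates of the preferred chart at `p`,
of a map `f` from an `n`-manifold to `ℝⁿ⁺¹`. -/
def partialDeriv {n : ℕ} {M : Type*} [TopologicalSpace M]
    [ChartedSpace (EuclideanSpace ℝ (Fin n)) M]
    (f : M → EuclideanSpace ℝ (Fin (n + 1))) (p : M) (i : Fin n) :
    EuclideanSpace ℝ (Fin (n + 1)) :=
  mfderiv (𝓡 n) 𝓘(ℝ, EuclideanSpace ℝ (Fin (n + 1))) f p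
    (EuclideanSpace.single i (1 : ℝ) : EuclideanSpace ℝ (Fin n))

/-- The induced metric `g_ij = ⟨∂_i f, ∂_j f⟩`. -/
def inducedMetric {n : ℕ} {M : Type*} [TopologicalSpace M]
    [ChartedSpace (EuclideanSpace ℝ (Fin n)) M]
    (f : M → EuclideanSpace ℝ (Fin (n + 1))) (p : M) : Matrix (Fin n) (Fin n) ℝ :=
  Matrix.of fun i j => inner ℝ (partialDeriv f p i) (partialDeriv f p j)

/-- The second fundamental form `h_ij = ⟨∂_i ν, ∂_j f⟩` of `f` with respect to the unit
normal field `ν`. -/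
def secondFundamentalForm {n : ℕ} {M : Type*} [TopologicalSpace M]
    [ChartedSpace (EuclideanSpace ℝ (Fin n)) M]
    (f ν : M → EuclideanSpace ℝ (Fin (n + 1))) (p : M) : Matrix (Fin n) (Fin n) ℝ :=
  Matrix.of fun i j => inner ℝ (partialDeriv ν p i) (partialDeriv f p j)

/-- The mean curvature `H = g^ij h_ij`: the sum of the principal curvatures, equal to `n` on the
unit sphere with its outward normal. -/
def meanCurvature {n : ℕ} {M : Type*} [TopologicalSpace M]
    [ChartedSpace (EuclideanSpace ℝ (Fin n)) M]
    (f ν : M → EuclideanSpace ℝ (Fin (n + 1))) (p : M) : ℝ :=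
  Matrix.trace ((inducedMetric f p)⁻¹ * secondFundamentalForm f ν p)

/-- `F t : M → ℝⁿ⁺¹`, `t ∈ [0, T]`, is a smooth solution of the inverse mean curvature flow
`∂F/∂t = H⁻¹ ν` with unit normal `ν t`: a smooth family of strictly mean convex immersed
hypersurfaces. As `H > 0`, the normal `ν` is the one opposite to the mean curvature vector. -/
structure IsSolution {n : ℕ} {M : Type*} [TopologicalSpace M]
    [ChartedSpace (EuclideanSpace ℝ (Fin n)) M] (T : ℝ)
    (F ν : ℝ → M → EuclideanSpace ℝ (Fin (n + 1))) : Prop where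
  smooth : ContMDiffOn ((𝓡 n).prod 𝓘(ℝ, ℝ)) 𝓘(ℝ, EuclideanSpace ℝ (Fin (n + 1))) ∞
    (fun q : M × ℝ => F q.2 q.1) (univ ×ˢ Icc 0 T)
  smooth_normal : ContMDiffOn ((𝓡 n).prod 𝓘(ℝ, ℝ)) 𝓘(ℝ, EuclideanSpace ℝ (Fin (n + 1))) ∞
    (fun q : M × ℝ => ν q.2 q.1) (univ ×ˢ Icc 0 T)
  immersion : ∀ t ∈ Icc 0 T, ∀ p : M, Function.Injective
    (mfderiv (𝓡 n) 𝓘(ℝ, EuclideanSpace ℝ (Fin (n + 1))) (F t) p)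
  norm_normal : ∀ t ∈ Icc 0 T, ∀ p : M, ‖ν t p‖ = 1
  orthogonal_normal : ∀ t ∈ Icc 0 T, ∀ (p : M) (i : Fin n),
    inner ℝ (partialDeriv (F t) p i) (ν t p) = 0
  meanCurvature_pos : ∀ t ∈ Icc 0 T, ∀ p : M, 0 < meanCurvature (F t) (ν t) p
  evolution : ∀ t ∈ Icc 0 T, ∀ p : M,
    HasDerivWithinAt (fun τ => F τ p) ((meanCurvature (F t) (ν t) p)⁻¹ • ν t p) (Icc 0 T) t

end

end IMCF

/-! Write u = 1/H, w = ⟨F, ν⟩ and ρ = |F|²/2. In a frame orthonormal at the point, u and w solve the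
same linear equation, (∂ₜ − u²Δ)φ = u²|A|²φ, while (∂ₜ − u²Δ)ρ = 2uw − nu² (`evolution_speed`,
`evolution_support`, `evolution_half_normSq_position`). Moreover u²|A|² ≥ 1/n, by Cauchy–Schwarz.
The maximum principle then gives three preliminary facts: w stays positive (by comparison with u), w
≥ R₁e^{t/n}, and ρ ≤ (R₂²/2)e^{2t/n}. The last needs |F| ≤ R₂ at time 0, which holds because F is
normal to the hypersurface where |F| is maximal.

The smoothing comes from comparing u with a multiple of f = w − λρ, where λ = (R₁/R₂²)e^{−t/n}. The
preliminary bounds give w/2 ≤ f ≤ w and λf ≥ 1/(2K²), with K = R₂/R₁. If u first touches mYf with m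
> 1 and Y = 8 + 2Kt^{−1/2}, the linear reaction terms have a favourable sign, and ρ contributes
mYλ(2uw − nu²), which is negative of order Y³ because u is large compared with w. This beats the
growth Kt^{−3/2} coming from −Y′, so no touching occurs (`not_touching`). Hence u ≤ Yf ≤ Yw, and w ≤
|F| ≤ R₂e^{t/n} finishes the estimate.

All uses of the maximum principle go through `touching_inequality`, which treats any combination au
+ bw + cρ + d with coefficients depending on time. -/

namespace IMCF

/-! ### Differentiating the trace of G⁻¹h -/

section TraceDerivative

variable {P : Type*} [NormedAddCommGroup P] [NormedSpace ℝ P]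

open scoped Matrix.Norms.Operator in
/-- The derivative of an entry of the inverse of a matrix field, at a point where the field is the
identity. -/
theorem hasFDerivAt_inv_apply {n : ℕ} {G : P → Matrix (Fin n) (Fin n) ℝ} {z : P}
    (hG : ∀ i j, DifferentiableAt ℝ (fun y => G y i j) z) (h1 : G z = 1) (i j : Fin n) :
    HasFDerivAt (fun y => (G y)⁻¹ i j) (-fderiv ℝ (fun y => G y i j) z) z := by
  have hsum : ∀ y, G y = ∑ a, ∑ b, G y a b • Matrix.single a b (1 : ℝ) := by
    intro y
    conv_lhs => rw [Matrix.matrix_eq_sum_single (G y)]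
    simp [Matrix.smul_single]
  have hD : HasFDerivAt G
      (∑ a, ∑ b, (fderiv ℝ (fun y => G y a b) z).smulRight (Matrix.single a b (1 : ℝ))) z := by
    have hab : ∀ a b, HasFDerivAt (fun y => G y a b • Matrix.single a b (1 : ℝ))
        ((fderiv ℝ (fun y => G y a b) z).smulRight (Matrix.single a b (1 : ℝ))) z :=
      fun a b => (hG a b).hasFDerivAt.smul_const _
    have hS : HasFDerivAt (fun y => ∑ a, ∑ b, G y a b • Matrix.single a b (1 : ℝ))
        (∑ a, ∑ b, (fderiv ℝ (fun y => G y a b) z).smulRight (Matrix.single a b (1 : ℝ))) z :=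
      HasFDerivAt.fun_sum fun a _ => HasFDerivAt.fun_sum fun b _ => hab a b
    exact hS.congr_of_eventuallyEq (Filter.Eventually.of_forall hsum)
  have hinv := hasFDerivAt_ringInverse (𝕜 := ℝ) (1 : (Matrix (Fin n) (Fin n) ℝ)ˣ)
  rw [Units.val_one, ← h1, inv_one] at hinv
  let π : Matrix (Fin n) (Fin n) ℝ →L[ℝ] ℝ :=
    LinearMap.toContinuousLinearMap (Matrix.entryLinearMap ℝ ℝ i j)
  have hc := (π.hasFDerivAt.comp z (hinv.comp z hD))
  refine (hc.congr_fderiv ?_).congr_of_eventuallyEq (Filter.Eventually.of_forall fun y => ?_)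
  · ext v
    change (-((1 : Matrix (Fin n) (Fin n) ℝ) * (∑ a, ∑ b, (fderiv ℝ (fun y => G y a b) z).smulRight
      (Matrix.single a b (1 : ℝ)) : P →L[ℝ] Matrix (Fin n) (Fin n) ℝ) v * 1) :
        Matrix (Fin n) (Fin n) ℝ) i j = _
    simp [Matrix.sum_apply, Matrix.single_apply, ite_and]
  · simp [π, Matrix.nonsing_inv_eq_ringInverse]

/-- Normalising G to the identity at the point reduces the derivative of the inverse to −dG, so no
index has to be raised. -/
theorem fderiv_trace_inv_mul {n : ℕ} {G h : P → Matrix (Fin n) (Fin n) ℝ} {z : P}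
    (hG : ∀ i j, DifferentiableAt ℝ (fun y => G y i j) z)
    (hh : ∀ i j, DifferentiableAt ℝ (fun y => h y i j) z) (h1 : G z = 1) (d : P) :
    fderiv ℝ (fun y => Matrix.trace ((G y)⁻¹ * h y)) z d =
      ∑ i, fderiv ℝ (fun y => h y i i) z d -
        ∑ i, ∑ j, fderiv ℝ (fun y => G y i j) z d * h z j i := by
  have : HasFDerivAt (fun y => ∑ i, ∑ j, (G y)⁻¹ i j * h y j i) _ z :=
    HasFDerivAt.fun_sum fun i _ => HasFDerivAt.fun_sum fun j _ =>
      (hasFDerivAt_inv_apply hG h1 i j).mul (hh j i).hasFDerivAt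
  have he : (fun y => Matrix.trace ((G y)⁻¹ * h y)) =
      fun y => ∑ i, ∑ j, (G y)⁻¹ i j * h y j i := by
    funext y; simp [Matrix.trace, Matrix.mul_apply]
  rw [he, this.fderiv, ← Finset.sum_sub_distrib]
  simp only [_root_.sum_apply, _root_.add_apply,
    _root_.smul_apply, _root_.neg_apply, smul_eq_mul, h1, inv_one]
  refine Finset.sum_congr rfl fun i _ => ?_
  rw [Finset.sum_add_distrib]
  simp [Matrix.one_apply, Finset.sum_neg_distrib, mul_comm]
  ring

end TraceDerivative

/-! ### Calculus of derivatives in constant directions -/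

section DirDeriv

variable {P V : Type*} [NormedAddCommGroup P] [NormedSpace ℝ P]
  [NormedAddCommGroup V] [NormedSpace ℝ V]

/-- The derivative of `f` at `z` in the direction `d`. -/
noncomputable def dirDeriv (d : P) (f : P → V) (z : P) : V := fderiv ℝ f z d

theorem contDiffOn_dirDeriv {Ω : Set P} (hΩ : IsOpen Ω) {f : P → V} (hf : ContDiffOn ℝ ∞ f Ω)
    (d : P) : ContDiffOn ℝ ∞ (dirDeriv d f) Ω :=
  (hf.fderiv_of_isOpen hΩ (by simp)).clm_apply contDiffOn_const

theorem dirDeriv_congr {Ω : Set P} (hΩ : IsOpen Ω) {f g : P → V} (hfg : EqOn f g Ω) (d : P) :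
    EqOn (dirDeriv d f) (dirDeriv d g) Ω := fun z hz => by
  unfold dirDeriv
  rw [(hfg.eventuallyEq_of_mem (hΩ.mem_nhds hz)).fderiv_eq]

theorem dirDeriv_comm {Ω : Set P} (hΩ : IsOpen Ω) {f : P → V} (hf : ContDiffOn ℝ ∞ f Ω)
    (d d' : P) {z : P} (hz : z ∈ Ω) :
    dirDeriv d (dirDeriv d' f) z = dirDeriv d' (dirDeriv d f) z := by
  have hdiff : DifferentiableAt ℝ (fderiv ℝ f) z :=
    ((hf.fderiv_of_isOpen (m := ∞) hΩ (by simp)).contDiffAt (hΩ.mem_nhds hz)).differentiableAt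
      (by simp)
  have key : ∀ a b : P, dirDeriv a (dirDeriv b f) z = fderiv ℝ (fderiv ℝ f) z a b := by
    intro a b
    change fderiv ℝ (fun y => fderiv ℝ f y b) z a = _
    rw [fderiv_clm_apply hdiff (differentiableAt_const b)]
    simp
  rw [key, key]
  exact (hf.contDiffAt (hΩ.mem_nhds hz)).isSymmSndFDerivAt
    (by simpa using WithTop.coe_le_coe.2 (le_top : (2 : ℕ∞) ≤ ⊤)) d d'

theorem differentiableAt_of_isOpen {Ω : Set P} (hΩ : IsOpen Ω) {f : P → V}
    (hf : ContDiffOn ℝ ∞ f Ω) {z : P} (hz : z ∈ Ω) : DifferentiableAt ℝ f z :=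
  (hf.contDiffAt (hΩ.mem_nhds hz)).differentiableAt (by simp)

theorem dirDeriv_smul {Ω : Set P} (hΩ : IsOpen Ω) {u : P → ℝ} {f : P → V}
    (hu : ContDiffOn ℝ ∞ u Ω) (hf : ContDiffOn ℝ ∞ f Ω) (d : P) {z : P} (hz : z ∈ Ω) :
    dirDeriv d (fun y => u y • f y) z = dirDeriv d u z • f z + u z • dirDeriv d f z := by
  unfold dirDeriv
  rw [fderiv_fun_smul (differentiableAt_of_isOpen hΩ hu hz) (differentiableAt_of_isOpen hΩ hf hz)]
  simp [add_comm]

end DirDeriv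

section DirDerivInner

variable {P V : Type*} [NormedAddCommGroup P] [NormedSpace ℝ P]
  [NormedAddCommGroup V] [InnerProductSpace ℝ V]

theorem dirDeriv_inner {Ω : Set P} (hΩ : IsOpen Ω) {f g : P → V}
    (hf : ContDiffOn ℝ ∞ f Ω) (hg : ContDiffOn ℝ ∞ g Ω) (d : P) {z : P} (hz : z ∈ Ω) :
    dirDeriv d (fun y => inner ℝ (f y) (g y)) z =
      inner ℝ (dirDeriv d f z) (g z) + inner ℝ (f z) (dirDeriv d g z) := by
  unfold dirDeriv
  rw [fderiv_inner_apply ℝ (differentiableAt_of_isOpen hΩ hf hz)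
    (differentiableAt_of_isOpen hΩ hg hz), add_comm]

end DirDerivInner

/-! ### Frames adapted to a hypersurface -/

section Frame

variable {V : Type*} [NormedAddCommGroup V] [InnerProductSpace ℝ V]

/-- Parseval's identity in an orthonormal frame consisting of `n` vectors `a i` and a vector `ν`
of an `(n+1)`-dimensional space. -/
theorem inner_eq_sum_add_of_frame {n : ℕ} (hV : Module.finrank ℝ V = n + 1) {a : Fin n → V}
    {ν : V} (ha : ∀ i j, inner ℝ (a i) (a j) = if i = j then (1 : ℝ) else 0)
    (hν : inner ℝ ν ν = (1 : ℝ)) (haν : ∀ i, inner ℝ (a i) ν = (0 : ℝ)) (x y : V) :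
    inner ℝ x y = ∑ k, inner ℝ x (a k) * inner ℝ y (a k) + inner ℝ x ν * inner ℝ y ν := by
  have : FiniteDimensional ℝ V := Module.finite_of_finrank_pos (by omega)
  have hνa : ∀ i, inner ℝ ν (a i) = (0 : ℝ) := fun i => by rw [real_inner_comm]; exact haν i
  have ho : Orthonormal ℝ (Fin.cons ν a : Fin (n + 1) → V) := by
    rw [orthonormal_iff_ite]
    intro i j
    refine Fin.cases ?_ (fun i => ?_) i <;> refine Fin.cases ?_ (fun j => ?_) j
    · simpa using hν
    · simpa [(Fin.succ_ne_zero j).symm] using hνa j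
    · simpa [Fin.succ_ne_zero i] using haν i
    · simpa using ha i j
  let b := (basisOfOrthonormalOfCardEqFinrank ho (by simp [hV])).toOrthonormalBasis
    (by simpa using ho)
  have hb : ∀ i, b i = (Fin.cons ν a : Fin (n + 1) → V) i := fun i => by simp [b]
  rw [← b.sum_inner_mul_inner x y, Fin.sum_univ_succ]
  simp only [hb, Fin.cons_zero, Fin.cons_succ]
  rw [real_inner_comm ν y, add_comm]
  congr 1
  exact Finset.sum_congr rfl fun k _ => by rw [real_inner_comm (a k) y]

end Frame

/-! ### Evolution equations of a local flow -/

/-- A local inverse mean curvature flow on an open subset `Ω` of space-time `P`, with position `X`,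
normal `N` and speed `u`, for the spatial directions `e i` and the time direction `τ`. -/
structure LocalFlow {P V : Type*} [NormedAddCommGroup P] [NormedSpace ℝ P]
    [NormedAddCommGroup V] [InnerProductSpace ℝ V] {n : ℕ}
    (Ω : Set P) (X N : P → V) (u : P → ℝ) (e : Fin n → P) (τ : P) : Prop where
  isOpen : IsOpen Ω
  smooth : ContDiffOn ℝ ∞ X Ω
  smooth_normal : ContDiffOn ℝ ∞ N Ω
  smooth_speed : ContDiffOn ℝ ∞ u Ω
  unit : ∀ z ∈ Ω, inner ℝ (N z) (N z) = (1 : ℝ)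
  orthogonal : ∀ z ∈ Ω, ∀ i, inner ℝ (dirDeriv (e i) X z) (N z) = (0 : ℝ)
  evolution : ∀ z ∈ Ω, dirDeriv τ X z = u z • N z
  speed_pos : ∀ z ∈ Ω, 0 < u z
  speed : ∀ z ∈ Ω, Matrix.trace
    ((Matrix.of fun i j => inner ℝ (dirDeriv (e i) X z) (dirDeriv (e j) X z) :
        Matrix (Fin n) (Fin n) ℝ)⁻¹ *
      Matrix.of fun i j => inner ℝ (dirDeriv (e i) N z) (dirDeriv (e j) X z)) = (u z)⁻¹

namespace LocalFlow

variable {P V : Type*} [NormedAddCommGroup P] [NormedSpace ℝ P]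
  [NormedAddCommGroup V] [InnerProductSpace ℝ V] {n : ℕ}
  {Ω : Set P} {X N : P → V} {u : P → ℝ} {e : Fin n → P} {τ : P}

theorem inner_dirDeriv_normal (h : LocalFlow Ω X N u e τ) (d : P) {z : P} (hz : z ∈ Ω) :
    inner ℝ (N z) (dirDeriv d N z) = (0 : ℝ) := by
  have h1 := dirDeriv_inner h.isOpen h.smooth_normal h.smooth_normal d hz
  have h2 := dirDeriv_congr h.isOpen (g := fun _ => (1 : ℝ)) h.unit d hz
  rw [h1, real_inner_comm] at h2
  simp only [dirDeriv, fderiv_fun_const, Pi.zero_apply, _root_.zero_apply] at h2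
  simp only [dirDeriv]
  linarith

theorem inner_dirDeriv_dirDeriv (h : LocalFlow Ω X N u e τ) (d : P) (i : Fin n) {z : P}
    (hz : z ∈ Ω) : inner ℝ (dirDeriv d (dirDeriv (e i) X) z) (N z) =
      -inner ℝ (dirDeriv (e i) X z) (dirDeriv d N z) := by
  have h1 := dirDeriv_inner h.isOpen (contDiffOn_dirDeriv h.isOpen h.smooth (e i))
    h.smooth_normal d hz
  have h2 := dirDeriv_congr h.isOpen (g := fun _ => (0 : ℝ)) (fun y hy => h.orthogonal y hy i) d hz
  rw [h1] at h2
  have h3 : dirDeriv d (fun _ : P => (0 : ℝ)) z = 0 := by simp [dirDeriv]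
  linarith

/-- Differentiating the orthogonality relation expresses both sides through ⟨∂ᵢ∂ⱼX, N⟩, and the
constant directions commute. -/
theorem secondFundamentalForm_symm (h : LocalFlow Ω X N u e τ) (i j : Fin n) {z : P}
    (hz : z ∈ Ω) : inner ℝ (dirDeriv (e i) N z) (dirDeriv (e j) X z) =
      inner ℝ (dirDeriv (e j) N z) (dirDeriv (e i) X z) := by
  have h1 := h.inner_dirDeriv_dirDeriv (e i) j hz
  have h2 := h.inner_dirDeriv_dirDeriv (e j) i hz
  rw [dirDeriv_comm h.isOpen h.smooth (e i) (e j) hz] at h1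
  rw [real_inner_comm, real_inner_comm (dirDeriv (e i) X z)]
  linarith

theorem dirDeriv_time_dirDeriv (h : LocalFlow Ω X N u e τ) (d : P) {z : P} (hz : z ∈ Ω) :
    dirDeriv τ (dirDeriv d X) z = dirDeriv d u z • N z + u z • dirDeriv d N z := by
  rw [dirDeriv_comm h.isOpen h.smooth τ d hz,
    dirDeriv_congr h.isOpen (g := fun y => u y • N y) h.evolution d hz,
    dirDeriv_smul h.isOpen h.smooth_speed h.smooth_normal d hz]

theorem inner_dirDeriv_time_normal (h : LocalFlow Ω X N u e τ) (i : Fin n) {z : P}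
    (hz : z ∈ Ω) : inner ℝ (dirDeriv τ N z) (dirDeriv (e i) X z) = -dirDeriv (e i) u z := by
  have h1 := h.inner_dirDeriv_dirDeriv τ i hz
  rw [h.dirDeriv_time_dirDeriv (e i) hz, inner_add_left, inner_smul_left, inner_smul_left,
    h.unit z hz, real_inner_comm (N z) (dirDeriv (e i) N z),
    h.inner_dirDeriv_normal (e i) hz] at h1
  rw [real_inner_comm]
  simp at h1
  linarith

/-- Differentiating `⟨∂ᵢν, ∂ⱼX⟩`. -/
theorem dirDeriv_secondFundamentalForm (h : LocalFlow Ω X N u e τ) (d d₁ d₂ : P) {z : P}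
    (hz : z ∈ Ω) :
    dirDeriv d (fun y => inner ℝ (dirDeriv d₁ N y) (dirDeriv d₂ X y)) z =
      inner ℝ (dirDeriv d (dirDeriv d₁ N) z) (dirDeriv d₂ X z) +
        inner ℝ (dirDeriv d₁ N z) (dirDeriv d (dirDeriv d₂ X) z) :=
  dirDeriv_inner h.isOpen (contDiffOn_dirDeriv h.isOpen h.smooth_normal d₁)
    (contDiffOn_dirDeriv h.isOpen h.smooth d₂) d hz

theorem inner_eq_sum_add (h : LocalFlow Ω X N u e τ)
    (hV : Module.finrank ℝ V = n + 1) {z : P} (hz : z ∈ Ω)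
    (hg : ∀ i j,
      inner ℝ (dirDeriv (e i) X z) (dirDeriv (e j) X z) = if i = j then (1 : ℝ) else 0)
    (x y : V) :
    inner ℝ x y = ∑ k, inner ℝ x (dirDeriv (e k) X z) * inner ℝ y (dirDeriv (e k) X z) +
      inner ℝ x (N z) * inner ℝ y (N z) :=
  inner_eq_sum_add_of_frame hV hg (h.unit z hz) (h.orthogonal z hz) x y

/-- The tangential vector `∂_d ν` has no normal component. -/
theorem inner_dirDeriv_normal_eq_sum (h : LocalFlow Ω X N u e τ)
    (hV : Module.finrank ℝ V = n + 1) {z : P} (hz : z ∈ Ω)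
    (hg : ∀ i j,
      inner ℝ (dirDeriv (e i) X z) (dirDeriv (e j) X z) = if i = j then (1 : ℝ) else 0)
    (d : P) (x : V) :
    inner ℝ (dirDeriv d N z) x =
      ∑ k, inner ℝ (dirDeriv d N z) (dirDeriv (e k) X z) * inner ℝ x (dirDeriv (e k) X z) := by
  rw [h.inner_eq_sum_add hV hz hg, real_inner_comm (N z) (dirDeriv d N z),
    h.inner_dirDeriv_normal d hz]
  ring

/-- The derivative of the mean curvature `u⁻¹`, in a frame that is orthonormal at the point. -/
theorem dirDeriv_speed (h : LocalFlow Ω X N u e τ)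
    (hV : Module.finrank ℝ V = n + 1) {z : P} (hz : z ∈ Ω)
    (hg : ∀ i j,
      inner ℝ (dirDeriv (e i) X z) (dirDeriv (e j) X z) = if i = j then (1 : ℝ) else 0)
    (d : P) :
    dirDeriv d u z = -(u z ^ 2 *
      (∑ i, inner ℝ (dirDeriv d (dirDeriv (e i) N) z) (dirDeriv (e i) X z) -
        ∑ i, inner ℝ (dirDeriv (e i) N z) (dirDeriv d (dirDeriv (e i) X) z))) := by
  have hX := fun i => contDiffOn_dirDeriv h.isOpen h.smooth (e i)
  have hN := fun i => contDiffOn_dirDeriv h.isOpen h.smooth_normal (e i)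
  have hu0 : u z ≠ 0 := (h.speed_pos z hz).ne'
  have h1 := dirDeriv_congr h.isOpen h.speed d hz
  have h2 : dirDeriv d (fun y => (u y)⁻¹) z = -dirDeriv d u z / u z ^ 2 := by
    have := ((hasDerivAt_inv hu0).comp_hasFDerivAt z
      (differentiableAt_of_isOpen h.isOpen h.smooth_speed hz).hasFDerivAt).fderiv
    unfold dirDeriv
    rw [show (fun y => (u y)⁻¹) = Inv.inv ∘ u from rfl, this]
    simp
    ring
  have h3 := fderiv_trace_inv_mul (z := z) (d := d)
    (G := fun y => Matrix.of fun i j => inner ℝ (dirDeriv (e i) X y) (dirDeriv (e j) X y))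
    (h := fun y => Matrix.of fun i j => inner ℝ (dirDeriv (e i) N y) (dirDeriv (e j) X y))
    (fun i j => differentiableAt_of_isOpen h.isOpen ((hX i).inner ℝ (hX j)) hz)
    (fun i j => differentiableAt_of_isOpen h.isOpen ((hN i).inner ℝ (hX j)) hz)
    (by ext i j; simp [hg, Matrix.one_apply])
  change dirDeriv d _ z = ∑ i, dirDeriv d
      (fun y => inner ℝ (dirDeriv (e i) N y) (dirDeriv (e i) X y)) z -
    ∑ i, ∑ j, dirDeriv d (fun y => inner ℝ (dirDeriv (e i) X y) (dirDeriv (e j) X y)) z *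
      inner ℝ (dirDeriv (e j) N z) (dirDeriv (e i) X z) at h3
  rw [h1, h2] at h3
  -- By symmetry of the second fundamental form, the derivative of the metric produces ⟨∂ᵢN, ∂_d∂ᵢX⟩
  -- twice; one copy cancels against the product rule for hᵢᵢ.
  have h4 : ∑ i, ∑ j, dirDeriv d
        (fun y => inner ℝ (dirDeriv (e i) X y) (dirDeriv (e j) X y)) z *
        inner ℝ (dirDeriv (e j) N z) (dirDeriv (e i) X z) =
      2 * ∑ i, inner ℝ (dirDeriv (e i) N z) (dirDeriv d (dirDeriv (e i) X) z) := by
    have h5 : ∀ i j, dirDeriv d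
        (fun y => inner ℝ (dirDeriv (e i) X y) (dirDeriv (e j) X y)) z *
        inner ℝ (dirDeriv (e j) N z) (dirDeriv (e i) X z) =
      inner ℝ (dirDeriv (e i) N z) (dirDeriv (e j) X z) *
        inner ℝ (dirDeriv d (dirDeriv (e i) X) z) (dirDeriv (e j) X z) +
      inner ℝ (dirDeriv (e j) N z) (dirDeriv (e i) X z) *
        inner ℝ (dirDeriv d (dirDeriv (e j) X) z) (dirDeriv (e i) X z) := by
      intro i j
      rw [dirDeriv_inner h.isOpen (hX i) (hX j) d hz, h.secondFundamentalForm_symm i j hz,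
        real_inner_comm (dirDeriv d (dirDeriv (e j) X) z)]
      ring
    simp only [h5, Finset.sum_add_distrib]
    rw [Finset.sum_comm (f := fun i j => inner ℝ (dirDeriv (e j) N z) (dirDeriv (e i) X z) *
        inner ℝ (dirDeriv d (dirDeriv (e j) X) z) (dirDeriv (e i) X z)), ← two_mul]
    congr 1
    exact Finset.sum_congr rfl fun i _ => (h.inner_dirDeriv_normal_eq_sum hV hz hg _ _).symm
  rw [h4] at h3
  simp only [h.dirDeriv_secondFundamentalForm d _ _ hz, Finset.sum_add_distrib] at h3
  field_simp at h3
  linarith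

/-- The squared norm of the second fundamental form, in the frame `e`. -/
noncomputable def normSq (e : Fin n → P) (N : P → V) (z : P) : ℝ :=
  ∑ i, inner ℝ (dirDeriv (e i) N z) (dirDeriv (e i) N z)

/-- The Laplacian of `φ` for the induced metric, in a frame orthonormal at the point. -/
noncomputable def laplacian (e : Fin n → P) (X : P → V) (φ : P → ℝ) (z : P) : ℝ :=
  ∑ i, dirDeriv (e i) (dirDeriv (e i) φ) z -
    ∑ i, ∑ k, dirDeriv (e k) φ z *
      inner ℝ (dirDeriv (e i) (dirDeriv (e i) X) z) (dirDeriv (e k) X z)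

theorem inner_dirDeriv_time_normal_eq_sum (h : LocalFlow Ω X N u e τ)
    (hV : Module.finrank ℝ V = n + 1) {z : P} (hz : z ∈ Ω)
    (hg : ∀ i j,
      inner ℝ (dirDeriv (e i) X z) (dirDeriv (e j) X z) = if i = j then (1 : ℝ) else 0) (x : V) :
    inner ℝ (dirDeriv τ N z) x =
      -∑ k, dirDeriv (e k) u z * inner ℝ x (dirDeriv (e k) X z) := by
  rw [h.inner_dirDeriv_normal_eq_sum hV hz hg, ← Finset.sum_neg_distrib]
  exact Finset.sum_congr rfl fun k _ => by rw [h.inner_dirDeriv_time_normal k hz]; ring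

/-- The tangential part of ∂_τN is −∇u, and its divergence gives the Laplacian. The term |A|²u comes
from the motion of the metric, through ∂_τ∂ᵢX = (∂ᵢu)N + u∂ᵢN. -/
theorem evolution_speed (h : LocalFlow Ω X N u e τ)
    (hV : Module.finrank ℝ V = n + 1) {z : P} (hz : z ∈ Ω)
    (hg : ∀ i j,
      inner ℝ (dirDeriv (e i) X z) (dirDeriv (e j) X z) = if i = j then (1 : ℝ) else 0) :
    dirDeriv τ u z = u z ^ 2 * (laplacian e X u z + normSq e N z * u z) := by
  rw [h.dirDeriv_speed hV hz hg τ]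
  have h1 : ∀ i, inner ℝ (dirDeriv τ (dirDeriv (e i) N) z) (dirDeriv (e i) X z) =
      -dirDeriv (e i) (dirDeriv (e i) u) z + ∑ k, dirDeriv (e k) u z *
        inner ℝ (dirDeriv (e i) (dirDeriv (e i) X) z) (dirDeriv (e k) X z) := by
    intro i
    have h2 := dirDeriv_congr h.isOpen
      (g := fun y => -dirDeriv (e i) u y) (fun y hy => h.inner_dirDeriv_time_normal i hy) (e i) hz
    rw [h.dirDeriv_secondFundamentalForm (e i) τ (e i) hz,
      h.inner_dirDeriv_time_normal_eq_sum hV hz hg] at h2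
    have h3 : dirDeriv (e i) (fun y => -dirDeriv (e i) u y) z =
        -dirDeriv (e i) (dirDeriv (e i) u) z := by
      unfold dirDeriv
      rw [fderiv_fun_neg, _root_.neg_apply]
    rw [dirDeriv_comm h.isOpen h.smooth_normal τ (e i) hz]
    linarith
  have h2 : ∀ i, inner ℝ (dirDeriv (e i) N z) (dirDeriv τ (dirDeriv (e i) X) z) =
      inner ℝ (dirDeriv (e i) N z) (dirDeriv (e i) N z) * u z := by
    intro i
    rw [h.dirDeriv_time_dirDeriv (e i) hz, inner_add_right, inner_smul_right, inner_smul_right,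
      real_inner_comm, h.inner_dirDeriv_normal (e i) hz]
    ring
  simp only [h1, h2, laplacian, normSq, Finset.sum_add_distrib, Finset.sum_neg_distrib,
    Finset.sum_mul]
  ring

/-- Codazzi's equation, traced. -/
theorem sum_inner_dirDeriv_dirDeriv_normal (h : LocalFlow Ω X N u e τ)
    (hV : Module.finrank ℝ V = n + 1) {z : P} (hz : z ∈ Ω)
    (hg : ∀ i j,
      inner ℝ (dirDeriv (e i) X z) (dirDeriv (e j) X z) = if i = j then (1 : ℝ) else 0)
    (k : Fin n) :
    u z ^ 2 * ∑ i, inner ℝ (dirDeriv (e i) (dirDeriv (e i) N) z) (dirDeriv (e k) X z) =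
      -dirDeriv (e k) u z + u z ^ 2 *
        ∑ i, inner ℝ (dirDeriv (e k) N z) (dirDeriv (e i) (dirDeriv (e i) X) z) := by
  rw [h.dirDeriv_speed hV hz hg (e k)]
  have h1 : ∀ i, inner ℝ (dirDeriv (e k) (dirDeriv (e i) N) z) (dirDeriv (e i) X z) =
      inner ℝ (dirDeriv (e i) (dirDeriv (e i) N) z) (dirDeriv (e k) X z) +
        inner ℝ (dirDeriv (e i) N z) (dirDeriv (e k) (dirDeriv (e i) X) z) -
        inner ℝ (dirDeriv (e k) N z) (dirDeriv (e i) (dirDeriv (e i) X) z) := by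
    intro i
    -- Differentiating the symmetry hₖᵢ = hᵢₖ along eᵢ, with commuting derivatives, is the Codazzi
    -- equation with its Christoffel terms left explicit.
    have h2 := dirDeriv_congr h.isOpen
      (f := fun y => inner ℝ (dirDeriv (e k) N y) (dirDeriv (e i) X y))
      (fun y hy => h.secondFundamentalForm_symm k i hy) (e i) hz
    rw [h.dirDeriv_secondFundamentalForm _ _ _ hz, h.dirDeriv_secondFundamentalForm _ _ _ hz] at h2
    rw [dirDeriv_comm h.isOpen h.smooth_normal (e k) (e i) hz,
      dirDeriv_comm h.isOpen h.smooth (e k) (e i) hz]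
    linarith
  simp only [h1, Finset.sum_add_distrib, Finset.sum_sub_distrib]
  ring

theorem sum_secondFundamentalForm_diag (h : LocalFlow Ω X N u e τ) {z : P} (hz : z ∈ Ω)
    (hg : ∀ i j,
      inner ℝ (dirDeriv (e i) X z) (dirDeriv (e j) X z) = if i = j then (1 : ℝ) else 0) :
    ∑ i, inner ℝ (dirDeriv (e i) N z) (dirDeriv (e i) X z) = (u z)⁻¹ := by
  rw [← h.speed z hz]
  have : (Matrix.of fun i j => inner ℝ (dirDeriv (e i) X z) (dirDeriv (e j) X z) :
      Matrix (Fin n) (Fin n) ℝ) = 1 := by ext i j; simp [hg, Matrix.one_apply]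
  rw [this]
  simp [Matrix.trace]

/-- Geometrically, Δw = H + ⟨F, ∇H⟩ − |A|²w and ∂_τw = u − ⟨F, ∇u⟩. Since ∇u = −u²∇H and u²H = u,
the gradient terms match. -/
theorem evolution_support (h : LocalFlow Ω X N u e τ)
    (hV : Module.finrank ℝ V = n + 1) {z : P} (hz : z ∈ Ω)
    (hg : ∀ i j,
      inner ℝ (dirDeriv (e i) X z) (dirDeriv (e j) X z) = if i = j then (1 : ℝ) else 0) :
    dirDeriv τ (fun y => inner ℝ (X y) (N y)) z =
      u z ^ 2 * (laplacian e X (fun y => inner ℝ (X y) (N y)) z +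
        normSq e N z * inner ℝ (X z) (N z)) := by
  have hu0 : u z ≠ 0 := (h.speed_pos z hz).ne'
  have hX := fun i => contDiffOn_dirDeriv h.isOpen h.smooth (e i)
  have hN := fun i => contDiffOn_dirDeriv h.isOpen h.smooth_normal (e i)
  have hw : ∀ i, EqOn (dirDeriv (e i) (fun y => inner ℝ (X y) (N y)))
      (fun y => inner ℝ (X y) (dirDeriv (e i) N y)) Ω := fun i y hy => by
    rw [dirDeriv_inner h.isOpen h.smooth h.smooth_normal _ hy, h.orthogonal y hy, zero_add]
  have hww : ∀ i, dirDeriv (e i) (dirDeriv (e i) (fun y => inner ℝ (X y) (N y))) z =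
      inner ℝ (dirDeriv (e i) N z) (dirDeriv (e i) X z) +
        (∑ k, inner ℝ (X z) (dirDeriv (e k) X z) *
          inner ℝ (dirDeriv (e i) (dirDeriv (e i) N) z) (dirDeriv (e k) X z) -
        inner ℝ (X z) (N z) * inner ℝ (dirDeriv (e i) N z) (dirDeriv (e i) N z)) := by
    intro i
    rw [dirDeriv_congr h.isOpen (hw i) (e i) hz, dirDeriv_inner h.isOpen h.smooth (hN i) _ hz,
      h.inner_eq_sum_add hV hz hg (X z), real_inner_comm (dirDeriv (e i) N z)]
    have h1 := dirDeriv_congr h.isOpen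
      (g := fun _ => (0 : ℝ)) (fun y hy => h.inner_dirDeriv_normal (e i) hy) (e i) hz
    rw [dirDeriv_inner h.isOpen h.smooth_normal (hN i) _ hz,
      show dirDeriv (e i) (fun _ : P => (0 : ℝ)) z = 0 by simp [dirDeriv],
      real_inner_comm (dirDeriv (e i) (dirDeriv (e i) N) z)] at h1
    rw [eq_neg_of_add_eq_zero_right h1]
    ring
  have hH := h.sum_secondFundamentalForm_diag hz hg
  have hτ : dirDeriv τ (fun y => inner ℝ (X y) (N y)) z =
      u z - ∑ k, dirDeriv (e k) u z * inner ℝ (X z) (dirDeriv (e k) X z) := by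
    rw [dirDeriv_inner h.isOpen h.smooth h.smooth_normal _ hz, h.evolution z hz, inner_smul_left,
      h.unit z hz, real_inner_comm (dirDeriv τ N z),
      h.inner_dirDeriv_time_normal_eq_sum hV hz hg]
    simp
    ring
  have hcod : ∑ i, ∑ k, inner ℝ (X z) (dirDeriv (e k) X z) *
        inner ℝ (dirDeriv (e i) (dirDeriv (e i) N) z) (dirDeriv (e k) X z) =
      -(∑ k, dirDeriv (e k) u z * inner ℝ (X z) (dirDeriv (e k) X z)) / u z ^ 2 +
        ∑ i, ∑ k, inner ℝ (X z) (dirDeriv (e k) X z) *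
          inner ℝ (dirDeriv (e k) N z) (dirDeriv (e i) (dirDeriv (e i) X) z) := by
    rw [Finset.sum_comm, Finset.sum_comm (f := fun i k => inner ℝ (X z) (dirDeriv (e k) X z) *
          inner ℝ (dirDeriv (e k) N z) (dirDeriv (e i) (dirDeriv (e i) X) z)),
      neg_div, Finset.sum_div, ← Finset.sum_neg_distrib, ← Finset.sum_add_distrib]
    refine Finset.sum_congr rfl fun k _ => ?_
    have := h.sum_inner_dirDeriv_dirDeriv_normal hV hz hg k
    rw [← Finset.mul_sum, ← Finset.mul_sum]
    field_simp
    linear_combination (inner ℝ (X z) (dirDeriv (e k) X z)) * this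
  -- Self-adjointness of the Weingarten map turns the Christoffel term left by Codazzi into the one
  -- in `laplacian`, because ∂ₖw = ⟨X, ∂ₖN⟩.
  have hsymm : ∀ i, ∑ k, inner ℝ (X z) (dirDeriv (e k) X z) *
        inner ℝ (dirDeriv (e k) N z) (dirDeriv (e i) (dirDeriv (e i) X) z) =
      ∑ k, inner ℝ (X z) (dirDeriv (e k) N z) *
        inner ℝ (dirDeriv (e i) (dirDeriv (e i) X) z) (dirDeriv (e k) X z) := by
    intro i
    have h1 : ∀ k, inner ℝ (X z) (dirDeriv (e k) N z) = ∑ j,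
        inner ℝ (dirDeriv (e k) N z) (dirDeriv (e j) X z) *
          inner ℝ (X z) (dirDeriv (e j) X z) := fun k => by
      rw [real_inner_comm]; exact h.inner_dirDeriv_normal_eq_sum hV hz hg _ _
    simp only [h1, h.inner_dirDeriv_normal_eq_sum hV hz hg _
      (dirDeriv (e i) (dirDeriv (e i) X) z), Finset.sum_mul, Finset.mul_sum]
    rw [Finset.sum_comm]
    refine Finset.sum_congr rfl fun k _ => Finset.sum_congr rfl fun j _ => ?_
    rw [h.secondFundamentalForm_symm j k hz]
    ring
  simp only [hsymm] at hcod
  rw [hτ, laplacian, normSq]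
  simp only [hww, hw _ hz, Finset.sum_add_distrib, Finset.sum_sub_distrib, hH, hcod,
    ← Finset.mul_sum]
  field_simp
  ring

/-- Here ∂_τρ = uw and Δρ = n − Hw = n − w/u. -/
theorem evolution_half_normSq_position (h : LocalFlow Ω X N u e τ)
    (hV : Module.finrank ℝ V = n + 1) {z : P} (hz : z ∈ Ω)
    (hg : ∀ i j,
      inner ℝ (dirDeriv (e i) X z) (dirDeriv (e j) X z) = if i = j then (1 : ℝ) else 0) :
    dirDeriv τ (fun y => inner ℝ (X y) (X y) / 2) z =
      u z ^ 2 * laplacian e X (fun y => inner ℝ (X y) (X y) / 2) z +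
        (2 * u z * inner ℝ (X z) (N z) - n * u z ^ 2) := by
  have hu0 : u z ≠ 0 := (h.speed_pos z hz).ne'
  have hX := fun i => contDiffOn_dirDeriv h.isOpen h.smooth (e i)
  have hρ : ∀ d, EqOn (dirDeriv d (fun y => inner ℝ (X y) (X y) / 2))
      (fun y => inner ℝ (X y) (dirDeriv d X y)) Ω := fun d y hy => by
    have h1 := dirDeriv_inner h.isOpen h.smooth h.smooth d hy
    have h2 : DifferentiableAt ℝ (fun y => (inner ℝ (X y) (X y) : ℝ)) y :=
      differentiableAt_of_isOpen h.isOpen (h.smooth.inner ℝ h.smooth) hy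
    rw [real_inner_comm (X y) (dirDeriv d X y)] at h1
    simp only [dirDeriv, div_eq_mul_inv] at h1 ⊢
    rw [fderiv_mul_const h2, _root_.smul_apply, h1, smul_eq_mul]
    ring
  have hρρ : ∀ i, dirDeriv (e i) (dirDeriv (e i) (fun y => inner ℝ (X y) (X y) / 2)) z =
      1 + (∑ k, inner ℝ (X z) (dirDeriv (e k) X z) *
          inner ℝ (dirDeriv (e i) (dirDeriv (e i) X) z) (dirDeriv (e k) X z) -
        inner ℝ (X z) (N z) * inner ℝ (dirDeriv (e i) N z) (dirDeriv (e i) X z)) := by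
    intro i
    rw [dirDeriv_congr h.isOpen (hρ (e i)) (e i) hz, dirDeriv_inner h.isOpen h.smooth (hX i) _ hz,
      h.inner_eq_sum_add hV hz hg (X z), h.inner_dirDeriv_dirDeriv _ _ hz, hg, if_pos rfl,
      real_inner_comm (dirDeriv (e i) N z)]
    ring
  have hτ : dirDeriv τ (fun y => inner ℝ (X y) (X y) / 2) z = u z * inner ℝ (X z) (N z) := by
    refine (hρ τ hz).trans ?_
    change inner ℝ (X z) (dirDeriv τ X z) = _
    rw [h.evolution z hz, inner_smul_right]
  rw [hτ, laplacian]
  simp only [hρρ, hρ _ hz, Finset.sum_add_distrib, Finset.sum_sub_distrib, ← Finset.mul_sum,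
    h.sum_secondFundamentalForm_diag hz hg]
  simp only [Finset.sum_const, Finset.card_univ, Fintype.card_fin, nsmul_eq_mul, mul_one]
  field_simp
  ring

/-- Cauchy–Schwarz for the trace: H² ≤ n ∑ hᵢᵢ² ≤ n|A|². -/
theorem inv_sq_le_normSq (h : LocalFlow Ω X N u e τ)
    (hV : Module.finrank ℝ V = n + 1) {z : P} (hz : z ∈ Ω)
    (hg : ∀ i j,
      inner ℝ (dirDeriv (e i) X z) (dirDeriv (e j) X z) = if i = j then (1 : ℝ) else 0) :
    1 ≤ n * (u z ^ 2 * normSq e N z) := by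
  have hu := h.speed_pos z hz
  have h1 := sq_sum_le_card_mul_sum_sq (s := Finset.univ)
    (f := fun i => (inner ℝ (dirDeriv (e i) N z) (dirDeriv (e i) X z) : ℝ))
  rw [h.sum_secondFundamentalForm_diag hz hg] at h1
  have h2 : ∑ i, (inner ℝ (dirDeriv (e i) N z) (dirDeriv (e i) X z) : ℝ) ^ 2 ≤ normSq e N z := by
    refine Finset.sum_le_sum fun i _ => ?_
    rw [h.inner_dirDeriv_normal_eq_sum hV hz hg (e i) (dirDeriv (e i) N z)]
    simp only [← sq]
    exact Finset.single_le_sum (f := fun k =>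
      (inner ℝ (dirDeriv (e i) N z) (dirDeriv (e k) X z) : ℝ) ^ 2)
      (fun k _ => sq_nonneg _) (Finset.mem_univ i)
  simp only [Finset.card_univ, Fintype.card_fin] at h1
  have h3 : (u z)⁻¹ ^ 2 ≤ n * normSq e N z :=
    h1.trans (mul_le_mul_of_nonneg_left h2 (Nat.cast_nonneg n))
  calc (1 : ℝ) = u z ^ 2 * (u z)⁻¹ ^ 2 := by field_simp
    _ ≤ u z ^ 2 * (n * normSq e N z) := mul_le_mul_of_nonneg_left h3 (sq_nonneg _)
    _ = _ := by ring

end LocalFlow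

/-! ### Derivative tests at a spatial maximum -/

/-- A positive second derivative would make the point a local minimum too, so f would be locally
constant and the second derivative zero. -/
theorem deriv_deriv_nonpos_of_isLocalMax {f : ℝ → ℝ} {x : ℝ} (hf : ContinuousAt f x)
    (hmax : IsLocalMax f x) : deriv (deriv f) x ≤ 0 := by
  by_contra! hpos
  have hmin := isLocalMin_of_deriv_deriv_pos hpos hmax.deriv_eq_zero hf
  have hconst : f =ᶠ[nhds x] fun _ => f x := by
    filter_upwards [hmax, hmin] with y h1 h2 using le_antisymm h1 h2
  have h2 : deriv (deriv f) x = 0 := by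
    rw [hconst.deriv.deriv_eq]
    simp
  exact hpos.ne' h2

section LineDerivatives

variable {P : Type*} [NormedAddCommGroup P] [NormedSpace ℝ P]

theorem hasDerivAt_line {V : Type*} [NormedAddCommGroup V] [NormedSpace ℝ V] {f : P → V}
    {z d : P} {s : ℝ} (hf : DifferentiableAt ℝ f (z + s • d)) :
    HasDerivAt (fun r : ℝ => f (z + r • d)) (dirDeriv d f (z + s • d)) s := by
  have h1 : HasDerivAt (fun r : ℝ => z + r • d) d s := by
    simpa using ((hasDerivAt_id s).smul_const d).const_add z
  exact hf.hasFDerivAt.comp_hasDerivAt s h1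

theorem dirDeriv_of_isLocalMax_line {Ω : Set P} (hΩ : IsOpen Ω) {f : P → ℝ}
    (hf : ContDiffOn ℝ ∞ f Ω) {z d : P} (hz : z ∈ Ω)
    (hmax : IsLocalMax (fun s : ℝ => f (z + s • d)) 0) :
    dirDeriv d f z = 0 ∧ dirDeriv d (dirDeriv d f) z ≤ 0 := by
  have hcont : ContinuousAt (fun s : ℝ => z + s • d) 0 := by fun_prop
  have hmem : ∀ᶠ s : ℝ in nhds 0, z + s • d ∈ Ω :=
    hcont.eventually (hΩ.mem_nhds (by simpa using hz))
  have h1 : deriv (fun s : ℝ => f (z + s • d)) =ᶠ[nhds 0] fun s => dirDeriv d f (z + s • d) := by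
    filter_upwards [hmem] with s hs
    exact (hasDerivAt_line (differentiableAt_of_isOpen hΩ hf hs)).deriv
  have hz' : z + (0 : ℝ) • d ∈ Ω := by simpa using hz
  constructor
  · have := h1.self_of_nhds
    rw [hmax.deriv_eq_zero] at this
    simpa using this.symm
  · have h2 := deriv_deriv_nonpos_of_isLocalMax
      (hasDerivAt_line (differentiableAt_of_isOpen hΩ hf hz')).continuousAt hmax
    rw [h1.deriv_eq, (hasDerivAt_line (differentiableAt_of_isOpen hΩ
      (contDiffOn_dirDeriv hΩ hf d) hz')).deriv] at h2
    simpa using h2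

theorem dirDeriv_lincomb {Ω : Set P} (hΩ : IsOpen Ω) {f g k : P → ℝ} (hf : ContDiffOn ℝ ∞ f Ω)
    (hg : ContDiffOn ℝ ∞ g Ω) (hk : ContDiffOn ℝ ∞ k Ω) (a b c : ℝ) (d : P) :
    EqOn (dirDeriv d (fun y => a * f y + b * g y + c * k y))
      (fun y => a * dirDeriv d f y + b * dirDeriv d g y + c * dirDeriv d k y) Ω := by
  intro y hy
  have h1 := (differentiableAt_of_isOpen hΩ hf hy).hasFDerivAt.const_mul a
  have h2 := (differentiableAt_of_isOpen hΩ hg hy).hasFDerivAt.const_mul b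
  have h3 := (differentiableAt_of_isOpen hΩ hk hy).hasFDerivAt.const_mul c
  have h4 := ((h1.add h2).add h3).fderiv
  unfold dirDeriv
  change fderiv ℝ (((fun y => a * f y) + fun y => b * g y) + fun y => c * k y) y d = _
  rw [h4]
  simp

end LineDerivatives

namespace LocalFlow

variable {P V : Type*} [NormedAddCommGroup P] [NormedSpace ℝ P]
  [NormedAddCommGroup V] [InnerProductSpace ℝ V] {n : ℕ}
  {Ω : Set P} {X N : P → V} {u : P → ℝ} {e : Fin n → P} {τ : P}

/-- The evolution inequality at a spatial maximum of a linear combination of the speed `u`, the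
support function `⟨X, N⟩` and `|X|² / 2`. -/
theorem time_derivative_le (h : LocalFlow Ω X N u e τ)
    (hV : Module.finrank ℝ V = n + 1) {z : P} (hz : z ∈ Ω)
    (hg : ∀ i j,
      inner ℝ (dirDeriv (e i) X z) (dirDeriv (e j) X z) = if i = j then (1 : ℝ) else 0)
    (a b c : ℝ)
    (hmax : ∀ i, IsLocalMax (fun s : ℝ => (fun y => a * u y + b * inner ℝ (X y) (N y) +
      c * (inner ℝ (X y) (X y) / 2)) (z + s • e i)) 0) :
    a * dirDeriv τ u z + b * dirDeriv τ (fun y => inner ℝ (X y) (N y)) z +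
        c * dirDeriv τ (fun y => inner ℝ (X y) (X y) / 2) z ≤
      u z ^ 2 * normSq e N z * (a * u z + b * inner ℝ (X z) (N z)) +
        c * (2 * u z * inner ℝ (X z) (N z) - n * u z ^ 2) := by
  have hu := h.smooth_speed
  have hw : ContDiffOn ℝ ∞ (fun y => (inner ℝ (X y) (N y) : ℝ)) Ω :=
    h.smooth.inner ℝ h.smooth_normal
  have hρ : ContDiffOn ℝ ∞ (fun y => (inner ℝ (X y) (X y) / 2 : ℝ)) Ω :=
    (h.smooth.inner ℝ h.smooth).div_const 2
  have hZ : ContDiffOn ℝ ∞ (fun y => a * u y + b * inner ℝ (X y) (N y) +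
      c * (inner ℝ (X y) (X y) / 2)) Ω :=
    ((contDiffOn_const.mul hu).add (contDiffOn_const.mul hw)).add (contDiffOn_const.mul hρ)
  have hD := fun d => dirDeriv_lincomb h.isOpen hu hw hρ a b c d
  have hmax' := fun i => dirDeriv_of_isLocalMax_line h.isOpen hZ hz (hmax i)
  have hlap : a * laplacian e X u z + b * laplacian e X (fun y => inner ℝ (X y) (N y)) z +
      c * laplacian e X (fun y => inner ℝ (X y) (X y) / 2) z ≤ 0 := by
    have h1 : ∀ i, a * dirDeriv (e i) u z + b * dirDeriv (e i) (fun y => inner ℝ (X y) (N y)) z +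
        c * dirDeriv (e i) (fun y => inner ℝ (X y) (X y) / 2) z = 0 := fun i =>
      (hD (e i) hz).symm.trans (hmax' i).1
    have h2 : ∀ i, a * dirDeriv (e i) (dirDeriv (e i) u) z +
        b * dirDeriv (e i) (dirDeriv (e i) (fun y => inner ℝ (X y) (N y))) z +
        c * dirDeriv (e i) (dirDeriv (e i) (fun y => inner ℝ (X y) (X y) / 2)) z ≤ 0 := by
      intro i
      have h3 := (hmax' i).2
      rw [dirDeriv_congr h.isOpen (hD (e i)) (e i) hz, dirDeriv_lincomb h.isOpen
        (contDiffOn_dirDeriv h.isOpen hu _) (contDiffOn_dirDeriv h.isOpen hw _)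
        (contDiffOn_dirDeriv h.isOpen hρ _) a b c (e i) hz] at h3
      exact h3
    refine le_trans (le_of_eq ?_) (Finset.sum_nonpos fun i (_ : i ∈ Finset.univ) => h2 i)
    unfold laplacian
    -- The gradient of the combination vanishes at the maximum, which removes the Christoffel terms
    -- and leaves only pure second derivatives.
    have h4 : ∑ i, ∑ k, (a * dirDeriv (e k) u z +
        b * dirDeriv (e k) (fun y => inner ℝ (X y) (N y)) z +
        c * dirDeriv (e k) (fun y => inner ℝ (X y) (X y) / 2) z) *
        inner ℝ (dirDeriv (e i) (dirDeriv (e i) X) z) (dirDeriv (e k) X z) = 0 := by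
      simp only [h1, zero_mul, Finset.sum_const_zero]
    simp only [add_mul, Finset.sum_add_distrib, mul_assoc, ← Finset.mul_sum] at h4
    simp only [Finset.sum_add_distrib, ← Finset.mul_sum]
    linarith
  rw [h.evolution_speed hV hz hg, h.evolution_support hV hz hg,
    h.evolution_half_normSq_position hV hz hg]
  have := mul_nonpos_of_nonneg_of_nonpos (sq_nonneg (u z)) hlap
  linarith

end LocalFlow

/-! ### Change of frame -/

/-- The trace of the second fundamental form does not depend on the frame. -/
theorem trace_inv_gram_mul_eq {V : Type*} [NormedAddCommGroup V] [InnerProductSpace ℝ V] {n : ℕ}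
    (L S : EuclideanSpace ℝ (Fin n) →L[ℝ] V) {b : Fin n → EuclideanSpace ℝ (Fin n)}
    (hb : LinearIndependent ℝ b) :
    Matrix.trace ((Matrix.of fun i j => inner ℝ (L (b i)) (L (b j)) :
        Matrix (Fin n) (Fin n) ℝ)⁻¹ * Matrix.of fun i j => inner ℝ (S (b i)) (L (b j))) =
      Matrix.trace ((Matrix.of fun i j => inner ℝ (L (EuclideanSpace.single i (1 : ℝ)))
          (L (EuclideanSpace.single j (1 : ℝ))) : Matrix (Fin n) (Fin n) ℝ)⁻¹ *
        Matrix.of fun i j => inner ℝ (S (EuclideanSpace.single i (1 : ℝ)))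
          (L (EuclideanSpace.single j (1 : ℝ)))) := by
  set B : Matrix (Fin n) (Fin n) ℝ := Matrix.of fun i k => b i k with hB
  have hunit : IsUnit B := by
    rw [← Matrix.linearIndependent_rows_iff_isUnit]
    exact hb.map' (WithLp.linearEquiv 2 ℝ (Fin n → ℝ)).toLinearMap (LinearEquiv.ker _)
  have hdet : IsUnit B.det := (Matrix.isUnit_iff_isUnit_det B).1 hunit
  have hexp : ∀ i, b i = ∑ k, B i k • EuclideanSpace.single k (1 : ℝ) := by
    intro i
    ext j
    simp [hB, Finset.sum_apply, Pi.single_apply]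
  have hform : ∀ A C : EuclideanSpace ℝ (Fin n) →L[ℝ] V,
      (Matrix.of fun i j => inner ℝ (A (b i)) (C (b j)) : Matrix (Fin n) (Fin n) ℝ) =
      B * (Matrix.of fun i j => inner ℝ (A (EuclideanSpace.single i (1 : ℝ)))
          (C (EuclideanSpace.single j (1 : ℝ)))) * B.transpose := by
    intro A C
    ext i j
    simp only [Matrix.of_apply, hexp, map_sum, map_smul, sum_inner, inner_sum, inner_smul_left,
      inner_smul_right, Matrix.mul_apply, Matrix.transpose_apply, Finset.sum_mul]
    simp only [Finset.mul_sum, conj_trivial]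
    exact Finset.sum_congr rfl fun k _ => Finset.sum_congr rfl fun l _ => by ring
  rw [hform, hform, Matrix.mul_inv_rev, Matrix.mul_inv_rev, Matrix.mul_assoc, Matrix.trace_mul_comm]
  have hdet' : IsUnit B.transpose.det := by rwa [Matrix.det_transpose]
  simp only [Matrix.mul_assoc, Matrix.mul_nonsing_inv _ hdet',
    Matrix.nonsing_inv_mul_cancel_left _ _ hdet, Matrix.mul_one]

/-- An injective linear map carries some basis to an orthonormal family. -/
theorem exists_basis_map_orthonormal {V : Type*} [NormedAddCommGroup V] [InnerProductSpace ℝ V]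
    {n : ℕ} (L : EuclideanSpace ℝ (Fin n) →L[ℝ] V) (hL : Function.Injective L) :
    ∃ b : Module.Basis (Fin n) ℝ (EuclideanSpace ℝ (Fin n)),
      ∀ i j, inner ℝ (L (b i)) (L (b j)) = if i = j then (1 : ℝ) else 0 := by
  let f := LinearEquiv.ofInjective (L : EuclideanSpace ℝ (Fin n) →ₗ[ℝ] V) hL
  have hrank : Module.finrank ℝ (LinearMap.range (L : EuclideanSpace ℝ (Fin n) →ₗ[ℝ] V)) = n := by
    rw [← f.finrank_eq]; simp
  let o := (stdOrthonormalBasis ℝ (LinearMap.range (L : EuclideanSpace ℝ (Fin n) →ₗ[ℝ] V))).reindex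
    (finCongr hrank)
  refine ⟨o.toBasis.map f.symm, fun i j => ?_⟩
  have hf : ∀ i, L ((o.toBasis.map f.symm) i) = (o i : V) := by
    intro i
    rw [Module.Basis.map_apply, OrthonormalBasis.coe_toBasis]
    exact congrArg Subtype.val (f.apply_symm_apply (o i))
  rw [hf, hf]
  have := orthonormal_iff_ite.1 o.orthonormal i j
  simpa using this

/-! ### Reading the flow in a chart -/

section Chart

variable {n : ℕ} {M : Type*} [TopologicalSpace M] [ChartedSpace (EuclideanSpace ℝ (Fin n)) M]

/-- A time-dependent map on `M`, read in the preferred chart at `p`. -/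
noncomputable def inChart {W : Type*} (G : ℝ → M → W) (p : M) (z : EuclideanSpace ℝ (Fin n) × ℝ) :
    W :=
  G z.2 ((extChartAt (𝓡 n) p).symm z.1)

variable {W : Type*} [NormedAddCommGroup W] [NormedSpace ℝ W]

theorem contDiffOn_inChart [IsManifold (𝓡 n) ∞ M] {G : ℝ → M → W} {s : Set ℝ}
    (hG : ContMDiffOn ((𝓡 n).prod 𝓘(ℝ, ℝ)) 𝓘(ℝ, W) ∞ (fun q : M × ℝ => G q.2 q.1) (univ ×ˢ s))
    (p : M) : ContDiffOn ℝ ∞ (inChart G p) ((extChartAt (𝓡 n) p).target ×ˢ s) := by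
  rw [← contMDiffOn_iff_contDiffOn]
  have h1 : ContMDiffOn 𝓘(ℝ, EuclideanSpace ℝ (Fin n) × ℝ) (𝓡 n) ∞
      (fun z : EuclideanSpace ℝ (Fin n) × ℝ => (extChartAt (𝓡 n) p).symm z.1)
      ((extChartAt (𝓡 n) p).target ×ˢ s) :=
    (contMDiffOn_extChartAt_symm p).comp (contDiff_fst.contMDiff.contMDiffOn) fun z hz => hz.1
  have h2 : ContMDiffOn 𝓘(ℝ, EuclideanSpace ℝ (Fin n) × ℝ) 𝓘(ℝ, ℝ) ∞
      (fun z : EuclideanSpace ℝ (Fin n) × ℝ => z.2)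
      ((extChartAt (𝓡 n) p).target ×ˢ s) := contDiff_snd.contMDiff.contMDiffOn
  exact hG.comp (h1.prodMk h2) fun z hz => ⟨mem_univ _, hz.2⟩

theorem contMDiff_slice {G : ℝ → M → W} {s : Set ℝ}
    (hG : ContMDiffOn ((𝓡 n).prod 𝓘(ℝ, ℝ)) 𝓘(ℝ, W) ∞ (fun q : M × ℝ => G q.2 q.1) (univ ×ˢ s))
    {t : ℝ} (ht : t ∈ s) : ContMDiff (𝓡 n) 𝓘(ℝ, W) ∞ (G t) := by
  have h1 : ContMDiff (𝓡 n) ((𝓡 n).prod 𝓘(ℝ, ℝ)) ∞ (fun p : M => (p, t)) :=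
    contMDiff_id.prodMk contMDiff_const
  exact contMDiffOn_univ.1 (hG.comp h1.contMDiffOn fun p _ => ⟨mem_univ _, ht⟩)

/-- Spatial derivatives in a chart, in terms of the intrinsic derivative. -/
theorem dirDeriv_inChart [IsManifold (𝓡 n) ∞ M] {G : ℝ → M → W} {s : Set ℝ} (hs : IsOpen s)
    (hG : ContMDiffOn ((𝓡 n).prod 𝓘(ℝ, ℝ)) 𝓘(ℝ, W) ∞ (fun q : M × ℝ => G q.2 q.1) (univ ×ˢ s))
    (p : M) {z : EuclideanSpace ℝ (Fin n) × ℝ}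
    (hz : z ∈ (extChartAt (𝓡 n) p).target ×ˢ s) (v : EuclideanSpace ℝ (Fin n)) :
    dirDeriv (v, 0) (inChart G p) z =
      (mfderiv (𝓡 n) 𝓘(ℝ, W) (G z.2) ((extChartAt (𝓡 n) p).symm z.1) :
        EuclideanSpace ℝ (Fin n) →L[ℝ] W)
      ((mfderiv 𝓘(ℝ, EuclideanSpace ℝ (Fin n)) (𝓡 n) (extChartAt (𝓡 n) p).symm z.1 :
        EuclideanSpace ℝ (Fin n) →L[ℝ] EuclideanSpace ℝ (Fin n)) v) := by
  have hΩ : IsOpen ((extChartAt (𝓡 n) p).target ×ˢ s) := (isOpen_extChartAt_target p).prod hs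
  have hd := differentiableAt_of_isOpen hΩ (contDiffOn_inChart hG p) hz
  have h1 : HasFDerivAt (fun x : EuclideanSpace ℝ (Fin n) => (x, z.2))
      (ContinuousLinearMap.inl ℝ _ ℝ) z.1 := hasFDerivAt_prodMk_left z.1 z.2
  have h2 : HasFDerivAt (G z.2 ∘ (extChartAt (𝓡 n) p).symm) _ z.1 :=
    HasFDerivAt.comp z.1 (g := inChart G p) hd.hasFDerivAt h1
  have hsymm : MDifferentiableAt 𝓘(ℝ, EuclideanSpace ℝ (Fin n)) (𝓡 n)
      (extChartAt (𝓡 n) p).symm z.1 :=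
    ((contMDiffOn_extChartAt_symm (n := ∞) p).contMDiffAt
      ((isOpen_extChartAt_target p).mem_nhds hz.1)).mdifferentiableAt (by simp)
  have h3 := mfderiv_comp z.1 (((contMDiff_slice hG hz.2).mdifferentiable (by simp)) _) hsymm
  rw [mfderiv_eq_fderiv, h2.fderiv] at h3
  have h4 := congrArg (fun A : EuclideanSpace ℝ (Fin n) →L[ℝ] W => A v) h3
  exact h4

theorem injective_mfderiv_extChartAt_symm [IsManifold (𝓡 n) ∞ M] (p : M)
    {x : EuclideanSpace ℝ (Fin n)} (hx : x ∈ (extChartAt (𝓡 n) p).target) :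
    Function.Injective (mfderiv 𝓘(ℝ, EuclideanSpace ℝ (Fin n)) (𝓡 n)
      (extChartAt (𝓡 n) p).symm x) := by
  have : IsManifold (𝓡 n) 1 M := IsManifold.of_le (n := ∞) (by simp)
  obtain ⟨A, hA⟩ := isInvertible_mfderivWithin_extChartAt_symm hx
  rw [modelWithCornersSelf_coe, range_id, mfderivWithin_univ] at hA
  rw [← hA]
  exact A.injective

end Chart

theorem inner_map_eq_zero_of_single {V : Type*} [NormedAddCommGroup V] [InnerProductSpace ℝ V]
    {n : ℕ} (L : EuclideanSpace ℝ (Fin n) →L[ℝ] V) {y : V}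
    (h : ∀ k, inner ℝ (L (EuclideanSpace.single k (1 : ℝ))) y = (0 : ℝ))
    (v : EuclideanSpace ℝ (Fin n)) : inner ℝ (L v) y = (0 : ℝ) := by
  have hv : v = ∑ k, v k • EuclideanSpace.single k (1 : ℝ) := by
    ext j; simp [Finset.sum_apply, Pi.single_apply]
  rw [hv, map_sum, sum_inner]
  refine Finset.sum_eq_zero fun k _ => ?_
  rw [map_smul, inner_smul_left, h k, mul_zero]

/-! ### From solutions on the manifold to local flows -/

section Solution

variable {n : ℕ} {M : Type*} [TopologicalSpace M] [ChartedSpace (EuclideanSpace ℝ (Fin n)) M]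

theorem continuousOn_of_inChart {W : Type*} [TopologicalSpace W] {G : ℝ → M → W} {s : Set ℝ}
    (hG : ∀ p, ContinuousOn (inChart G p) ((extChartAt (𝓡 n) p).target ×ˢ s)) :
    ContinuousOn (fun q : M × ℝ => G q.2 q.1) (univ ×ˢ s) := by
  rintro ⟨p, t⟩ ⟨-, ht⟩
  have hmem : (extChartAt (𝓡 n) p).source ×ˢ (univ : Set ℝ) ∈ nhds (p, t) :=
    prod_mem_nhds (extChartAt_source_mem_nhds p) Filter.univ_mem
  have h1 : ContinuousOn (fun q : M × ℝ => inChart G p (extChartAt (𝓡 n) p q.1, q.2))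
      ((extChartAt (𝓡 n) p).source ×ˢ s) := by
    refine (hG p).comp (((continuousOn_extChartAt p).comp continuousOn_fst fun q hq => hq.1).prodMk
      continuousOn_snd) fun q hq => ⟨(extChartAt (𝓡 n) p).map_source hq.1, hq.2⟩
  have h2 : ContinuousOn (fun q : M × ℝ => G q.2 q.1) ((extChartAt (𝓡 n) p).source ×ˢ s) :=
    h1.congr fun q hq => by simp only [inChart, (extChartAt (𝓡 n) p).left_inv hq.1]
  refine (h2 (p, t) ⟨mem_extChartAt_source p, ht⟩).mono_of_mem_nhdsWithin ?_
  filter_upwards [mem_nhdsWithin_of_mem_nhds hmem, self_mem_nhdsWithin] with q hq hq'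
  exact ⟨hq.1, hq'.2⟩

/-- The speed `1 / H` of the flow. -/
noncomputable def speed (F ν : ℝ → M → EuclideanSpace ℝ (Fin (n + 1))) (t : ℝ) (p : M) : ℝ :=
  (meanCurvature (F t) (ν t) p)⁻¹

/-- The support function `⟨F, ν⟩`. -/
noncomputable def support (F ν : ℝ → M → EuclideanSpace ℝ (Fin (n + 1))) (t : ℝ) (p : M) : ℝ :=
  inner ℝ (F t p) (ν t p)

/-- Half of the squared distance to the origin. -/
noncomputable def halfNormSq (F : ℝ → M → EuclideanSpace ℝ (Fin (n + 1))) (t : ℝ) (p : M) : ℝ :=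
  inner ℝ (F t p) (F t p) / 2

variable {T : ℝ} {F ν : ℝ → M → EuclideanSpace ℝ (Fin (n + 1))}

namespace IsSolution

theorem speed_pos (h : IsSolution T F ν) {t : ℝ} (ht : t ∈ Icc 0 T) (p : M) :
    0 < speed F ν t p := inv_pos.2 (h.meanCurvature_pos t ht p)

theorem inner_normal_normal (h : IsSolution T F ν) {t : ℝ} (ht : t ∈ Icc 0 T) (p : M) :
    inner ℝ (ν t p) (ν t p) = (1 : ℝ) := by
  rw [real_inner_self_eq_norm_sq, h.norm_normal t ht p]; norm_num

theorem continuousOn_support (h : IsSolution T F ν) :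
    ContinuousOn (fun q : M × ℝ => support F ν q.2 q.1) (univ ×ˢ Icc 0 T) :=
  h.smooth.continuousOn.inner h.smooth_normal.continuousOn

theorem continuousOn_halfNormSq (h : IsSolution T F ν) :
    ContinuousOn (fun q : M × ℝ => halfNormSq F q.2 q.1) (univ ×ˢ Icc 0 T) :=
  (h.smooth.continuousOn.inner h.smooth.continuousOn).div_const 2

variable [IsManifold (𝓡 n) ∞ M]

/-- `meanCurvature` uses a different preferred chart at each point, so its smoothness is not visible
from its definition. The flow equation gives 1/H = ⟨∂ₜF, ν⟩, which is smooth up to both end times.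
-/
theorem contDiffOn_speed (h : IsSolution T F ν) (hT : 0 < T) (p : M) :
    ContDiffOn ℝ ∞ (inChart (speed F ν) p) ((extChartAt (𝓡 n) p).target ×ˢ Icc 0 T) := by
  have hu : UniqueDiffOn ℝ ((extChartAt (𝓡 n) p).target ×ˢ Icc 0 T) :=
    (isOpen_extChartAt_target p).uniqueDiffOn.prod (uniqueDiffOn_Icc hT)
  have hX := contDiffOn_inChart h.smooth p
  have h1 : ContDiffOn ℝ ∞ (fun z => (inner ℝ
      (fderivWithin ℝ (inChart F p) ((extChartAt (𝓡 n) p).target ×ˢ Icc 0 T) z (0, 1))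
      (inChart ν p z) : ℝ)) ((extChartAt (𝓡 n) p).target ×ˢ Icc 0 T) :=
    ((hX.fderivWithin hu (m := ∞) (by simp)).clm_apply contDiffOn_const).inner ℝ
      (contDiffOn_inChart h.smooth_normal p)
  refine h1.congr fun z hz => ?_
  have hd : HasDerivWithinAt (fun t : ℝ => ((z.1, t) : EuclideanSpace ℝ (Fin n) × ℝ)) (0, 1)
      (Icc 0 T) z.2 := (hasDerivWithinAt_const z.2 (Icc 0 T) z.1).prodMk (hasDerivWithinAt_id _ _)
  have hmaps : MapsTo (fun t : ℝ => ((z.1, t) : EuclideanSpace ℝ (Fin n) × ℝ)) (Icc 0 T)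
      ((extChartAt (𝓡 n) p).target ×ˢ Icc 0 T) := fun t ht => ⟨hz.1, ht⟩
  have h2 : HasDerivWithinAt (fun t : ℝ => inChart F p (z.1, t))
      (fderivWithin ℝ (inChart F p) ((extChartAt (𝓡 n) p).target ×ˢ Icc 0 T) z (0, 1))
      (Icc 0 T) z.2 := by
    have hl := ((hX z hz).differentiableWithinAt (by simp)).hasFDerivWithinAt
    exact hl.comp_hasDerivWithinAt z.2 hd hmaps
  have h3 := (uniqueDiffOn_Icc hT z.2 hz.2).eq_deriv _ h2
    (h.evolution z.2 hz.2 ((extChartAt (𝓡 n) p).symm z.1))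
  rw [h3, inChart, inChart, inner_smul_left, h.inner_normal_normal hz.2]
  simp [speed]

theorem continuousOn_speed (h : IsSolution T F ν) (hT : 0 < T) :
    ContinuousOn (fun q : M × ℝ => speed F ν q.2 q.1) (univ ×ˢ Icc 0 T) :=
  continuousOn_of_inChart fun p => (h.contDiffOn_speed hT p).continuousOn

/-- In a chart, and with respect to any basis of the coordinate space, a solution is a local
flow. -/
theorem localFlow (h : IsSolution T F ν) (hT : 0 < T) (p : M)
    (b : Module.Basis (Fin n) ℝ (EuclideanSpace ℝ (Fin n))) :
    LocalFlow ((extChartAt (𝓡 n) p).target ×ˢ Ioo 0 T) (inChart F p) (inChart ν p)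
      (inChart (speed F ν) p) (fun i => (b i, 0)) (0, 1) := by
  have hΩ : IsOpen ((extChartAt (𝓡 n) p).target ×ˢ Ioo 0 T) :=
    (isOpen_extChartAt_target p).prod isOpen_Ioo
  have hsub : (extChartAt (𝓡 n) p).target ×ˢ Ioo 0 T ⊆ (extChartAt (𝓡 n) p).target ×ˢ Icc 0 T :=
    prod_mono_right Ioo_subset_Icc_self
  have hsub' : (univ : Set M) ×ˢ Ioo 0 T ⊆ univ ×ˢ Icc 0 T := prod_mono_right Ioo_subset_Icc_self
  have hF := h.smooth.mono hsub'
  have hν := h.smooth_normal.mono hsub'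
  have hIcc : ∀ z ∈ (extChartAt (𝓡 n) p).target ×ˢ Ioo 0 T, z.2 ∈ Icc 0 T :=
    fun z hz => Ioo_subset_Icc_self hz.2
  refine ⟨hΩ, contDiffOn_inChart hF p, contDiffOn_inChart hν p, (h.contDiffOn_speed hT p).mono hsub,
    fun z hz => h.inner_normal_normal (hIcc z hz) _, fun z hz i => ?_, fun z hz => ?_,
    fun z hz => h.speed_pos (hIcc z hz) _, fun z hz => ?_⟩
  · rw [dirDeriv_inChart isOpen_Ioo hF p hz]
    exact inner_map_eq_zero_of_single _ (h.orthogonal_normal z.2 (hIcc z hz) _) _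
  · have h1 := hasDerivAt_line (d := ((0, 1) : EuclideanSpace ℝ (Fin n) × ℝ)) (s := 0) (z := z)
      (by simpa using differentiableAt_of_isOpen hΩ (contDiffOn_inChart hF p) hz)
    have h2 : HasDerivAt (fun r : ℝ => F (z.2 + r) ((extChartAt (𝓡 n) p).symm z.1))
        (inChart (speed F ν) p z • inChart ν p z) 0 := by
      have h3 := (h.evolution z.2 (hIcc z hz) ((extChartAt (𝓡 n) p).symm z.1)).hasDerivAt
        (Icc_mem_nhds hz.2.1 hz.2.2)
      have h4 : HasDerivAt (fun r : ℝ => z.2 + r) 1 0 := (hasDerivAt_id 0).const_add _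
      have h5 := HasDerivAt.scomp (0 : ℝ) (h := fun r : ℝ => z.2 + r)
        (g₁ := fun τ => F τ ((extChartAt (𝓡 n) p).symm z.1)) (by simpa using h3) h4
      rw [one_smul] at h5
      exact h5
    have h6 : (fun r : ℝ => inChart F p (z + r • ((0, 1) : EuclideanSpace ℝ (Fin n) × ℝ))) =
        fun r : ℝ => F (z.2 + r) ((extChartAt (𝓡 n) p).symm z.1) := by
      funext r; simp [inChart]
    rw [h6] at h1
    simpa using h1.unique h2
  · simp only [dirDeriv_inChart isOpen_Ioo hF p hz, dirDeriv_inChart isOpen_Ioo hν p hz]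
    -- Away from p, `meanCurvature` refers to the preferred chart of the nearby point, not to the
    -- chart at p; frame independence of the trace reconciles the two.
    refine (trace_inv_gram_mul_eq _ _ (b.linearIndependent.map'
      (mfderiv 𝓘(ℝ, EuclideanSpace ℝ (Fin n)) (𝓡 n) (extChartAt (𝓡 n) p).symm z.1 :
        EuclideanSpace ℝ (Fin n) →L[ℝ] EuclideanSpace ℝ (Fin n)).toLinearMap
      (LinearMap.ker_eq_bot.2 (injective_mfderiv_extChartAt_symm p hz.1)))).trans ?_
    rw [inChart, speed, inv_inv]
    rfl

/-- The evolution inequality at a spatial maximum of a linear combination of the speed, the support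
function and half of the squared distance to the origin; here `A` is the squared norm of the second
fundamental form. -/
theorem exists_time_derivative_le (h : IsSolution T F ν) {t : ℝ} (ht : t ∈ Ioo 0 T) (p : M) :
    ∃ A u' w' ρ' : ℝ, 1 ≤ n * (speed F ν t p ^ 2 * A) ∧
      HasDerivAt (fun τ => speed F ν τ p) u' t ∧ HasDerivAt (fun τ => support F ν τ p) w' t ∧
      HasDerivAt (fun τ => halfNormSq F τ p) ρ' t ∧
      ∀ a b c : ℝ, (∀ q, a * speed F ν t q + b * support F ν t q + c * halfNormSq F t q ≤
          a * speed F ν t p + b * support F ν t p + c * halfNormSq F t p) →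
        a * u' + b * w' + c * ρ' ≤
          speed F ν t p ^ 2 * A * (a * speed F ν t p + b * support F ν t p) +
            c * (2 * speed F ν t p * support F ν t p - n * speed F ν t p ^ 2) := by
  have hT : 0 < T := ht.1.trans ht.2
  have htI : t ∈ Icc 0 T := Ioo_subset_Icc_self ht
  set x := extChartAt (𝓡 n) p p with hx
  have hxp : (extChartAt (𝓡 n) p).symm x = p := extChartAt_to_inv p
  have hz : ((x, t) : EuclideanSpace ℝ (Fin n) × ℝ) ∈ (extChartAt (𝓡 n) p).target ×ˢ Ioo 0 T :=
    ⟨mem_extChartAt_target p, ht⟩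
  have hF := h.smooth.mono (prod_mono_right (s := (univ : Set M))
    (Ioo_subset_Icc_self (a := (0 : ℝ)) (b := T)))
  let L : EuclideanSpace ℝ (Fin n) →L[ℝ] EuclideanSpace ℝ (Fin (n + 1)) :=
    mfderiv (𝓡 n) 𝓘(ℝ, EuclideanSpace ℝ (Fin (n + 1))) (F t) ((extChartAt (𝓡 n) p).symm x)
  let J : EuclideanSpace ℝ (Fin n) →L[ℝ] EuclideanSpace ℝ (Fin n) :=
    mfderiv 𝓘(ℝ, EuclideanSpace ℝ (Fin n)) (𝓡 n) (extChartAt (𝓡 n) p).symm x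
  have hL : Function.Injective L := h.immersion t htI _
  have hJ : Function.Injective J := injective_mfderiv_extChartAt_symm p hz.1
  -- The basis is fixed in coordinates, so its directions commute; it is orthonormal for the induced
  -- metric only at the point (x, t), which is all that is needed.
  obtain ⟨b, hb⟩ := exists_basis_map_orthonormal (L.comp J) (hL.comp hJ)
  have hflow := h.localFlow hT p b
  have hg : ∀ i j, inner ℝ (dirDeriv ((b i, 0) : EuclideanSpace ℝ (Fin n) × ℝ) (inChart F p) (x, t))
      (dirDeriv ((b j, 0) : EuclideanSpace ℝ (Fin n) × ℝ) (inChart F p) (x, t)) =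
      if i = j then (1 : ℝ) else 0 := fun i j => by
    rw [dirDeriv_inChart isOpen_Ioo hF p hz, dirDeriv_inChart isOpen_Ioo hF p hz]
    exact hb i j
  have hV : Module.finrank ℝ (EuclideanSpace ℝ (Fin (n + 1))) = n + 1 := by simp
  have htime : ∀ {f : EuclideanSpace ℝ (Fin n) × ℝ → ℝ},
      ContDiffOn ℝ ∞ f ((extChartAt (𝓡 n) p).target ×ˢ Ioo 0 T) →
      HasDerivAt (fun τ => f (x, τ)) (dirDeriv (0, 1) f (x, t)) t := by
    intro f hf
    have h1 : HasDerivAt (fun τ : ℝ => ((x, τ) : EuclideanSpace ℝ (Fin n) × ℝ)) (0, 1) t :=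
      (hasDerivAt_const t x).prodMk (hasDerivAt_id t)
    exact (differentiableAt_of_isOpen hflow.isOpen hf hz).hasFDerivAt.comp_hasDerivAt t h1
  have hu := htime hflow.smooth_speed
  have hw := htime (hflow.smooth.inner ℝ hflow.smooth_normal)
  have hρ := htime ((hflow.smooth.inner ℝ hflow.smooth).div_const 2)
  have h1 := hflow.inv_sq_le_normSq hV hz hg
  simp only [inChart, hxp] at hu hw hρ h1
  refine ⟨_, _, _, _, h1, hu, hw, hρ, fun α β γ hmax => ?_⟩
  have h2 := hflow.time_derivative_le hV hz hg α β γ fun i => ?_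
  · simpa only [inChart, hxp, support] using h2
  · refine Filter.Eventually.of_forall fun s => ?_
    have h3 := hmax ((extChartAt (𝓡 n) p).symm (x + s • b i))
    simp only [inChart, Prod.fst_add, Prod.snd_add, Prod.smul_mk, smul_zero, add_zero, zero_smul,
      hxp]
    exact h3

end IsSolution

end Solution

/-! ### Maximum principle and preliminary bounds -/

/-- At a first touching only earlier times are controlled, so the sign is read off from left
difference quotients. -/
theorem deriv_nonneg_of_le_left {f : ℝ → ℝ} {f' r t : ℝ} (hf : HasDerivAt f f' t) (hr : r < t)
    (h : ∀ τ ∈ Ioc r t, f τ ≤ f t) : 0 ≤ f' := by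
  have h1 := (hasDerivWithinAt_iff_tendsto_slope' (s := Iio t) (by simp)).1
    (hf.hasDerivWithinAt (s := Iio t))
  refine ge_of_tendsto h1 ?_
  filter_upwards [Ioo_mem_nhdsLT hr] with τ hτ
  rw [slope_def_field]
  exact div_nonneg_of_nonpos (by linarith [h τ ⟨hτ.1, hτ.2.le⟩]) (by linarith [hτ.2])

theorem le_of_forall_pos_of_continuous {f : ℝ → ℝ} (hf : Continuous f) {c : ℝ}
    (h : ∀ δ > 0, f δ ≤ c) : f 0 ≤ c := by
  refine le_of_tendsto ((hf.tendsto 0).mono_left (nhdsWithin_le_nhds (s := Ioi 0))) ?_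
  filter_upwards [self_mem_nhdsWithin] with δ hδ using h δ hδ

section MaximumPrinciple

variable {n : ℕ} {M : Type*} [TopologicalSpace M] [ChartedSpace (EuclideanSpace ℝ (Fin n)) M]
  {T : ℝ} {F ν : ℝ → M → EuclideanSpace ℝ (Fin (n + 1))}

namespace IsSolution

theorem support_sq_le (h : IsSolution T F ν) {t : ℝ} (ht : t ∈ Icc 0 T) (p : M) :
    support F ν t p ^ 2 ≤ 2 * halfNormSq F t p := by
  have h1 := abs_real_inner_le_norm (F t p) (ν t p)
  rw [h.norm_normal t ht p, mul_one] at h1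
  rw [support, halfNormSq, real_inner_self_eq_norm_sq, ← sq_abs]
  have := pow_le_pow_left₀ (abs_nonneg _) h1 2
  linarith

variable [IsManifold (𝓡 n) ∞ M]

/-- The parabolic inequality at the first time at which a combination of the basic quantities, with
time-dependent coefficients, touches zero from below. -/
theorem touching_inequality (h : IsSolution T F ν) {t : ℝ} (ht : t ∈ Ioo 0 T) (p : M)
    {a b c d : ℝ → ℝ} {a' b' c' d' : ℝ} (ha : HasDerivAt a a' t) (hb : HasDerivAt b b' t)
    (hc : HasDerivAt c c' t) (hd : HasDerivAt d d' t)
    (hle : ∀ τ ∈ Ioc 0 t, ∀ q, a τ * speed F ν τ q + b τ * support F ν τ q +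
      c τ * halfNormSq F τ q + d τ ≤ 0)
    (heq : a t * speed F ν t p + b t * support F ν t p + c t * halfNormSq F t p + d t = 0) :
    ∃ B : ℝ, 1 ≤ n * B ∧
      0 ≤ a' * speed F ν t p + b' * support F ν t p + c' * halfNormSq F t p + d' +
        B * (a t * speed F ν t p + b t * support F ν t p) +
        c t * (2 * speed F ν t p * support F ν t p - n * speed F ν t p ^ 2) := by
  obtain ⟨A, u', w', ρ', hA, hu, hw, hρ, hmax⟩ := h.exists_time_derivative_le ht p
  refine ⟨_, hA, ?_⟩
  have h1 := hmax (a t) (b t) (c t) fun q => by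
    linarith [hle t (right_mem_Ioc.2 ht.1) q]
  have h2 := deriv_nonneg_of_le_left
    ((((ha.fun_mul hu).fun_add (hb.fun_mul hw)).fun_add (hc.fun_mul hρ)).fun_add hd) ht.1
    fun τ hτ => (hle τ hτ p).trans heq.ge
  linarith

theorem exists_min [CompactSpace M] [Nonempty M] {S : ℝ} (hS : 0 ≤ S) {f : M × ℝ → ℝ}
    (hf : ContinuousOn f (univ ×ˢ Icc 0 S)) :
    ∃ p : M, ∃ t ∈ Icc 0 S, ∀ q, ∀ τ ∈ Icc 0 S, f (p, t) ≤ f (q, τ) := by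
  obtain ⟨⟨p, t⟩, hpt, hmin⟩ := (isCompact_univ.prod isCompact_Icc).exists_isMinOn
    ⟨(Classical.arbitrary M, 0), mem_univ _, left_mem_Icc.2 hS⟩ hf
  exact ⟨p, t, hpt.2, fun q τ hτ => hmin (a := (q, τ)) ⟨mem_univ _, hτ⟩⟩

variable [CompactSpace M]

/-- Since u > 0 solves the same linear equation as w, the minimum of w/u cannot decrease. Comparing
with u, not with a constant, makes the reaction term vanish at the touching point, so the unknown
sign of w is harmless. -/
theorem support_pos (h : IsSolution T F ν) (h0 : ∀ p, 0 < support F ν 0 p) {t : ℝ}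
    (ht : t ∈ Ico 0 T) (p : M) : 0 < support F ν t p := by
  have hT : 0 < T := ht.1.trans_lt ht.2
  have : Nonempty M := ⟨p⟩
  have hsub : (univ : Set M) ×ˢ Icc 0 t ⊆ univ ×ˢ Icc 0 T :=
    prod_mono_right (Icc_subset_Icc_right ht.2.le)
  have hIcc : ∀ τ ∈ Icc 0 t, τ ∈ Icc 0 T := fun τ hτ => ⟨hτ.1, hτ.2.trans ht.2.le⟩
  have hquot : ContinuousOn (fun q : M × ℝ => support F ν q.2 q.1 / speed F ν q.2 q.1)
      (univ ×ˢ Icc 0 t) :=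
    (h.continuousOn_support.mono hsub).div ((h.continuousOn_speed hT).mono hsub)
      fun q hq => (h.speed_pos (hIcc _ hq.2) _).ne'
  obtain ⟨c, hc, hcle⟩ : ∃ c > 0, ∀ q, c ≤ support F ν 0 q / speed F ν 0 q := by
    obtain ⟨q₀, t₀, ht₀, hq₀⟩ := exists_min le_rfl
      (hquot.mono (prod_mono_right (Icc_subset_Icc_right ht.1)))
    obtain rfl : t₀ = 0 := le_antisymm ht₀.2 ht₀.1
    exact ⟨_, div_pos (h0 q₀) (h.speed_pos (left_mem_Icc.2 hT.le) _),
      fun q => hq₀ q 0 (left_mem_Icc.2 le_rfl)⟩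
  -- The perturbation makes the touching inequality strict, and is small enough that c − δt remains
  -- positive.
  set δ := c / (2 * (t + 1)) with hδ
  have hδ0 : 0 < δ := div_pos hc (by linarith [ht.1])
  obtain ⟨p₀, t₀, ht₀, hmin⟩ := exists_min ht.1
    (f := fun q : M × ℝ => support F ν q.2 q.1 / speed F ν q.2 q.1 + δ * q.2)
    (hquot.add (continuousOn_const.mul continuousOn_snd))
  set m := support F ν t₀ p₀ / speed F ν t₀ p₀ + δ * t₀ with hm
  have hlow : ∀ q, ∀ τ ∈ Icc 0 t, (m - δ * τ) * speed F ν τ q ≤ support F ν τ q := by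
    intro q τ hτ
    have h1 := hmin q τ hτ
    rw [← le_div_iff₀ (h.speed_pos (hIcc τ hτ) q)]
    simp only at h1
    linarith
  have hcm : c ≤ m := by
    rcases ht₀.1.eq_or_lt with h1 | h1
    · rw [hm, ← h1]
      simpa using hcle p₀
    · exfalso
      have hu := h.speed_pos (hIcc t₀ ht₀) p₀
      have heq : (m - δ * t₀) * speed F ν t₀ p₀ = support F ν t₀ p₀ := by
        rw [hm]; field_simp; ring
      obtain ⟨B, -, hB⟩ := h.touching_inequality ⟨h1, ht₀.2.trans_lt ht.2⟩ p₀
        (a := fun τ => m - δ * τ) (b := fun _ => -1) (c := fun _ => 0) (d := fun _ => 0)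
        (((hasDerivAt_id t₀).const_mul δ).const_sub m) (hasDerivAt_const _ _)
        (hasDerivAt_const _ _) (hasDerivAt_const _ _)
        (fun τ hτ q => by linarith [hlow q τ ⟨hτ.1.le, hτ.2.trans ht₀.2⟩]) (by linarith)
      rw [heq] at hB
      nlinarith [mul_pos hδ0 hu]
  have h2 := hlow p t (right_mem_Icc.2 ht.1)
  have h3 : δ * t < c := by
    rw [hδ, div_mul_eq_mul_div, div_lt_iff₀ (by linarith [ht.1])]
    nlinarith [ht.1]
  exact (mul_pos (by linarith) (h.speed_pos ⟨ht.1, ht.2.le⟩ p)).trans_le h2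

/-- At a spatial minimum ∂ₜw ≥ u²|A|²w ≥ w/n, using w > 0. The rate is lowered by δ to get a strict
contradiction, and then δ → 0. -/
theorem le_support (h : IsSolution T F ν) (hn : 1 ≤ n) {R : ℝ} (hR : 0 < R)
    (h0 : ∀ p, R ≤ support F ν 0 p) {t : ℝ} (ht : t ∈ Ico 0 T) (p : M) :
    R * Real.exp (t / n) ≤ support F ν t p := by
  have : Nonempty M := ⟨p⟩
  have hn0 : (0 : ℝ) < n := by exact_mod_cast hn
  have hsub : (univ : Set M) ×ˢ Icc 0 t ⊆ univ ×ˢ Icc 0 T :=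
    prod_mono_right (Icc_subset_Icc_right ht.2.le)
  have hpos : ∀ τ ∈ Icc 0 t, ∀ q, 0 < support F ν τ q := fun τ hτ q =>
    h.support_pos (fun q => hR.trans_le (h0 q)) ⟨hτ.1, hτ.2.trans_lt ht.2⟩ q
  have key : ∀ δ > 0, R * Real.exp ((1 / n - δ) * t) ≤ support F ν t p := by
    intro δ hδ
    obtain ⟨p₀, t₀, ht₀, hmin⟩ := exists_min ht.1
      (f := fun q : M × ℝ => support F ν q.2 q.1 * Real.exp (-((1 / n - δ) * q.2)))
      ((h.continuousOn_support.mono hsub).mul (by fun_prop))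
    set m := support F ν t₀ p₀ * Real.exp (-((1 / n - δ) * t₀)) with hm
    have hlow : ∀ q, ∀ τ ∈ Icc 0 t, m * Real.exp ((1 / n - δ) * τ) ≤ support F ν τ q := by
      intro q τ hτ
      have h1 := hmin q τ hτ
      simp only [Real.exp_neg] at h1
      rwa [← div_eq_mul_inv, le_div_iff₀ (Real.exp_pos _)] at h1
    have hcm : R ≤ m := by
      rcases ht₀.1.eq_or_lt with h1 | h1
      · rw [hm, ← h1]
        simpa using h0 p₀
      · exfalso
        have hw := hpos t₀ ht₀ p₀
        have heq : m * Real.exp ((1 / n - δ) * t₀) = support F ν t₀ p₀ := by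
          rw [hm, mul_assoc, ← Real.exp_add]; simp
        have hd : HasDerivAt (fun τ => m * Real.exp ((1 / n - δ) * τ))
            (m * (Real.exp ((1 / n - δ) * t₀) * ((1 / n - δ) * 1))) t₀ :=
          (((hasDerivAt_id t₀).const_mul (1 / (n : ℝ) - δ)).exp).const_mul m
        obtain ⟨B, hB1, hB⟩ := h.touching_inequality ⟨h1, ht₀.2.trans_lt ht.2⟩ p₀
          (a := fun _ => 0) (b := fun _ => -1) (c := fun _ => 0)
          (hasDerivAt_const _ _) (hasDerivAt_const _ _) (hasDerivAt_const _ _) hd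
          (fun τ hτ q => by linarith [hlow q τ ⟨hτ.1.le, hτ.2.trans ht₀.2⟩]) (by linarith)
        rw [mul_one, ← mul_assoc, heq] at hB
        have hB2 : 1 / (n : ℝ) ≤ B := by rwa [div_le_iff₀ hn0, mul_comm]
        nlinarith [mul_pos hδ hw, mul_le_mul_of_nonneg_right hB2 hw.le]
    exact (mul_le_mul_of_nonneg_right hcm (Real.exp_pos _).le).trans
      (hlow p t (right_mem_Icc.2 ht.1))
  have := le_of_forall_pos_of_continuous
    (f := fun δ => R * Real.exp ((1 / n - δ) * t)) (by fun_prop) key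
  simpa [div_eq_inv_mul] using this

/-- Completing the square in u gives 2uw − nu² ≤ w²/n ≤ 2ρ/n, so the maximum of ρ grows at rate at
most 2/n. Positivity of w ensures ρ > 0, which makes the δ-perturbation strict. -/
theorem halfNormSq_le (h : IsSolution T F ν) (hn : 1 ≤ n) {R : ℝ}
    (hw0 : ∀ p, 0 < support F ν 0 p) (h0 : ∀ p, halfNormSq F 0 p ≤ R) {t : ℝ}
    (ht : t ∈ Ico 0 T) (p : M) : halfNormSq F t p ≤ R * Real.exp (2 * t / n) := by
  have : Nonempty M := ⟨p⟩
  have hn0 : (0 : ℝ) < n := by exact_mod_cast hn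
  have hsub : (univ : Set M) ×ˢ Icc 0 t ⊆ univ ×ˢ Icc 0 T :=
    prod_mono_right (Icc_subset_Icc_right ht.2.le)
  have key : ∀ δ > 0, -(R * Real.exp ((2 / n + δ) * t)) ≤ -halfNormSq F t p := by
    intro δ hδ
    obtain ⟨p₀, t₀, ht₀, hmin⟩ := exists_min ht.1
      (f := fun q : M × ℝ => -(halfNormSq F q.2 q.1 * Real.exp (-((2 / n + δ) * q.2))))
      ((h.continuousOn_halfNormSq.mono hsub).mul (by fun_prop)).neg
    set m := halfNormSq F t₀ p₀ * Real.exp (-((2 / n + δ) * t₀)) with hm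
    have hup : ∀ q, ∀ τ ∈ Icc 0 t, halfNormSq F τ q ≤ m * Real.exp ((2 / n + δ) * τ) := by
      intro q τ hτ
      have h1 := neg_le_neg_iff.1 (hmin q τ hτ)
      simp only [Real.exp_neg] at h1
      rwa [← div_eq_mul_inv, div_le_iff₀ (Real.exp_pos _)] at h1
    have hcm : m ≤ R := by
      rcases ht₀.1.eq_or_lt with h1 | h1
      · rw [hm, ← h1]
        simpa using h0 p₀
      · exfalso
        have ht₀T : t₀ ∈ Icc 0 T := ⟨ht₀.1, ht₀.2.trans ht.2.le⟩
        have hw := h.support_pos hw0 ⟨ht₀.1, ht₀.2.trans_lt ht.2⟩ p₀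
        have hρw := h.support_sq_le ht₀T p₀
        have heq : m * Real.exp ((2 / n + δ) * t₀) = halfNormSq F t₀ p₀ := by
          rw [hm, mul_assoc, ← Real.exp_add]; simp
        have hd : HasDerivAt (fun τ => -(m * Real.exp ((2 / n + δ) * τ)))
            (-(m * (Real.exp ((2 / n + δ) * t₀) * ((2 / n + δ) * 1)))) t₀ :=
          ((((hasDerivAt_id t₀).const_mul (2 / (n : ℝ) + δ)).exp).const_mul m).fun_neg
        obtain ⟨B, hB1, hB⟩ := h.touching_inequality ⟨h1, ht₀.2.trans_lt ht.2⟩ p₀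
          (a := fun _ => 0) (b := fun _ => 0) (c := fun _ => 1)
          (hasDerivAt_const _ _) (hasDerivAt_const _ _) (hasDerivAt_const _ _) hd
          (fun τ hτ q => by linarith [hup q τ ⟨hτ.1.le, hτ.2.trans ht₀.2⟩]) (by linarith)
        rw [mul_one, ← mul_assoc, heq] at hB
        have h2 : 2 * speed F ν t₀ p₀ * support F ν t₀ p₀ - n * speed F ν t₀ p₀ ^ 2 ≤
            halfNormSq F t₀ p₀ * (2 / n) := by
          rw [← mul_div_assoc, le_div_iff₀ hn0]
          nlinarith [sq_nonneg (n * speed F ν t₀ p₀ - support F ν t₀ p₀)]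
        nlinarith [mul_pos hδ (pow_pos hw 2)]
    exact neg_le_neg ((hup p t (right_mem_Icc.2 ht.1)).trans
      (mul_le_mul_of_nonneg_right hcm (Real.exp_pos _).le))
  have := le_of_forall_pos_of_continuous
    (f := fun δ => -(R * Real.exp ((2 / n + δ) * t))) (by fun_prop) key
  have h2 := neg_le_neg_iff.1 this
  rwa [add_zero, div_mul_eq_mul_div] at h2

end IsSolution

end MaximumPrinciple

/-! ### The barrier and the smoothing estimate -/

/-- The algebra that excludes a first touching of `u` and the barrier `m Y f`, `f = w - lam ρ`. -/
theorem not_touching {N B m s K u w ρ lam f Y : ℝ} (hN : 1 ≤ N) (hB1 : 1 ≤ N * B) (hm : 1 < m)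
    (hs : 0 < s) (hK : 0 < K) (hf : 0 < f) (hlam : 0 < lam) (hρ : 0 ≤ ρ) (hfdef : f = w - lam * ρ)
    (hwf : w ≤ 2 * f) (hlf : 1 ≤ 2 * K ^ 2 * (lam * f)) (hY : Y = 8 + 2 * K * s⁻¹)
    (hu : u = m * (Y * f))
    (h : 0 ≤ 0 * u + -(m * -(K / s ^ 3)) * w +
      m * (-(K / s ^ 3) * lam + Y * -(1 / N * lam)) * ρ + 0 +
      B * (1 * u + -(m * Y) * w) + m * (Y * lam) * (2 * u * w - N * u ^ 2)) : False := by
  have hs' : 0 < s⁻¹ := inv_pos.2 hs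
  have hY8 : 8 ≤ Y := by rw [hY]; nlinarith [mul_pos hK hs']
  have hYs : 2 * K * s⁻¹ ≤ Y := by rw [hY]; linarith
  have hB : 0 ≤ B := by
    by_contra! hneg
    nlinarith
  have hm0 : 0 < m := by linarith
  have hYf : 0 < Y * f := by positivity
  -- The two terms in ρ to be discarded have a good sign: one because λ decreases in time, the other
  -- because u − mYw = −mYλρ at the touching point.
  have h1 : 0 ≤ m * (Y * (1 / N * lam) * ρ) := by positivity
  have h2 : 0 ≤ B * (m * Y * (lam * ρ)) := by positivity
  have h3 : 0 ≤ m * (K / s ^ 3 * f + Y * lam * (2 * u * w - N * u ^ 2)) := by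
    have h4 : 1 * u + -(m * Y) * w = -(m * Y * (lam * ρ)) := by rw [hu, hfdef]; ring
    rw [h4] at h
    rw [hfdef]
    linarith
  have h5 : 0 ≤ K / s ^ 3 * f + Y * lam * (2 * u * w - N * u ^ 2) :=
    nonneg_of_mul_nonneg_right h3 hm0
  have huYf : Y * f ≤ u := by rw [hu]; nlinarith
  have hu0 : 0 < u := hYf.trans_le huYf
  -- The constant 8 in Y is used here: u ≥ 8f and w ≤ 2f give 2uw ≤ 4uf ≤ u²/2.
  have h6 : 2 * u * w - N * u ^ 2 ≤ -((Y * f) ^ 2 / 2) := by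
    have h7 : u * w ≤ u * (2 * f) := mul_le_mul_of_nonneg_left hwf hu0.le
    have h8 : u * (8 * f) ≤ u * u :=
      mul_le_mul_of_nonneg_left ((mul_le_mul_of_nonneg_right hY8 hf.le).trans huYf) hu0.le
    have h9 : (Y * f) ^ 2 ≤ u ^ 2 := pow_le_pow_left₀ hYf.le huYf 2
    have h10 : u ^ 2 ≤ N * u ^ 2 := le_mul_of_one_le_left (sq_nonneg u) hN
    nlinarith
  have h7 : Y * lam * (2 * u * w - N * u ^ 2) ≤ Y * lam * -((Y * f) ^ 2 / 2) :=
    mul_le_mul_of_nonneg_left h6 (by positivity)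
  have h8 : 0 ≤ f * (K / s ^ 3 - Y ^ 3 * (lam * f) / 2) := by nlinarith
  have h9 : 0 ≤ K / s ^ 3 - Y ^ 3 * (lam * f) / 2 := nonneg_of_mul_nonneg_right h8 hf
  -- The singular part of Y decides: Y³λf ≥ 8K³s⁻³λf ≥ 4K/s³, whereas the touching inequality allows
  -- at most 2K/s³.
  have h10 : (2 * K * s⁻¹) ^ 3 ≤ Y ^ 3 := pow_le_pow_left₀ (by positivity) hYs 3
  have h11 : (2 * K * s⁻¹) ^ 3 * (lam * f) ≤ Y ^ 3 * (lam * f) :=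
    mul_le_mul_of_nonneg_right h10 (by positivity)
  have h12 : (2 * K * s⁻¹) ^ 3 * (lam * f) = 4 * (K / s ^ 3) * (2 * K ^ 2 * (lam * f)) := by
    field_simp
    ring
  have h13 : 0 < K / s ^ 3 := by positivity
  nlinarith [mul_le_mul_of_nonneg_left hlf (mul_pos four_pos h13).le]

section Estimate

variable {n : ℕ} {M : Type*} [TopologicalSpace M] [ChartedSpace (EuclideanSpace ℝ (Fin n)) M]
  {T : ℝ} {F ν : ℝ → M → EuclideanSpace ℝ (Fin (n + 1))}

/-- At a maximum of `|f|`, the position `f` is orthogonal to the hypersurface. -/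
theorem inner_mfderiv_eq_zero_of_max {V : Type*} [NormedAddCommGroup V] [InnerProductSpace ℝ V]
    {f : M → V} {p : M} {L : EuclideanSpace ℝ (Fin n) →L[ℝ] V}
    (hf : HasMFDerivAt (𝓡 n) 𝓘(ℝ, V) f p L)
    (hmax : ∀ q, inner ℝ (f q) (f q) ≤ (inner ℝ (f p) (f p) : ℝ)) (v : EuclideanSpace ℝ (Fin n)) :
    inner ℝ (f p) (L v) = (0 : ℝ) := by
  set x := extChartAt (𝓡 n) p p with hx
  have hxp : (extChartAt (𝓡 n) p).symm x = p := extChartAt_to_inv p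
  have h1 : HasFDerivAt (f ∘ (extChartAt (𝓡 n) p).symm) L x := by
    have h2 := hf.2
    rw [modelWithCornersSelf_coe, range_id] at h2
    exact hasFDerivWithinAt_univ.1 h2
  have h3 : IsLocalMax (fun y => (inner ℝ ((f ∘ (extChartAt (𝓡 n) p).symm) y)
      ((f ∘ (extChartAt (𝓡 n) p).symm) y) : ℝ)) x :=
    Filter.Eventually.of_forall fun y => by
      simp only [Function.comp_apply, hxp]; exact hmax _
  have h4 := congrArg (fun A : EuclideanSpace ℝ (Fin n) →L[ℝ] ℝ => A v) h3.fderiv_eq_zero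
  rw [fderiv_inner_apply ℝ h1.differentiableAt h1.differentiableAt, h1.fderiv,
    real_inner_comm ((f ∘ (extChartAt (𝓡 n) p).symm) x), Function.comp_apply, hxp] at h4
  have h5 : ∀ r : ℝ, r + r = 0 → r = 0 := fun r hr => by linarith
  exact h5 _ h4

namespace IsSolution

theorem two_mul_halfNormSq_eq_of_max (h : IsSolution T F ν) {t : ℝ} (ht : t ∈ Icc 0 T) {p : M}
    (hmax : ∀ q, halfNormSq F t q ≤ halfNormSq F t p) :
    2 * halfNormSq F t p = support F ν t p ^ 2 := by
  let L : EuclideanSpace ℝ (Fin n) →L[ℝ] EuclideanSpace ℝ (Fin (n + 1)) :=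
    mfderiv (𝓡 n) 𝓘(ℝ, EuclideanSpace ℝ (Fin (n + 1))) (F t) p
  have hL : Function.Injective L := h.immersion t ht p
  obtain ⟨b, hb⟩ := exists_basis_map_orthonormal L hL
  have h1 := inner_eq_sum_add_of_frame (by simp) hb (h.inner_normal_normal ht p)
    (fun i => inner_map_eq_zero_of_single L (h.orthogonal_normal t ht p) (b i)) (F t p) (F t p)
  have h2 : ∀ i, inner ℝ (F t p) (L (b i)) = (0 : ℝ) := fun i =>
    inner_mfderiv_eq_zero_of_max
      (((contMDiff_slice h.smooth ht).mdifferentiable (by simp)) p).hasMFDerivAt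
      (fun q => by have := hmax q; simp only [halfNormSq] at this; linarith) (b i)
  simp only [h2, mul_zero, Finset.sum_const_zero, zero_add] at h1
  rw [halfNormSq, support, h1]
  ring

variable [CompactSpace M]

/-- Where |F| is maximal, F is normal, so |F| equals w there. -/
theorem halfNormSq_zero_le (h : IsSolution T F ν) (hT : 0 ≤ T) {R : ℝ}
    (hw0 : ∀ p, 0 < support F ν 0 p) (h0 : ∀ p, support F ν 0 p ≤ R) (p : M) :
    halfNormSq F 0 p ≤ R ^ 2 / 2 := by
  have : Nonempty M := ⟨p⟩
  obtain ⟨q₀, t₀, ht₀, hq₀⟩ := exists_min le_rfl (S := 0)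
    (h.continuousOn_halfNormSq.mono (prod_mono_right (Icc_subset_Icc_right hT))).neg
  obtain rfl : t₀ = 0 := le_antisymm ht₀.2 ht₀.1
  have hmax : ∀ q, halfNormSq F 0 q ≤ halfNormSq F 0 q₀ := fun q =>
    neg_le_neg_iff.1 (hq₀ q 0 (left_mem_Icc.2 le_rfl))
  have h1 := h.two_mul_halfNormSq_eq_of_max (left_mem_Icc.2 hT) hmax
  have h2 := pow_le_pow_left₀ (hw0 q₀).le (h0 q₀) 2
  linarith [hmax p]

variable [IsManifold (𝓡 n) ∞ M]

/-- The smoothing estimate for the speed, before the final time. -/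
theorem speed_le_of_lt (h : IsSolution T F ν) (hn : 1 ≤ n) {R₁ R₂ : ℝ} (hR₁ : 0 < R₁)
    (h₁ : ∀ p, R₁ ≤ support F ν 0 p) (h₂ : ∀ p, support F ν 0 p ≤ R₂) {t : ℝ} (ht : t ∈ Ioo 0 T)
    (p : M) : speed F ν t p ≤ (8 + 2 * (R₂ / R₁) * (Real.sqrt t)⁻¹) * (R₂ * Real.exp (t / n)) := by
  have : Nonempty M := ⟨p⟩
  have hT : 0 < T := ht.1.trans ht.2
  have hn1 : (1 : ℝ) ≤ n := by exact_mod_cast hn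
  have hR₂ : 0 < R₂ := hR₁.trans_le ((h₁ p).trans (h₂ p))
  have hsub : (univ : Set M) ×ˢ Icc 0 t ⊆ univ ×ˢ Icc 0 T :=
    prod_mono_right (Icc_subset_Icc_right ht.2.le)
  have hIcc : ∀ τ ∈ Icc 0 t, τ ∈ Icc 0 T := fun τ hτ => ⟨hτ.1, hτ.2.trans ht.2.le⟩
  have hIco : ∀ τ ∈ Icc 0 t, τ ∈ Ico 0 T := fun τ hτ => ⟨hτ.1, hτ.2.trans_lt ht.2⟩
  have hw0 : ∀ q, 0 < support F ν 0 q := fun q => hR₁.trans_le (h₁ q)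
  have hw : ∀ τ ∈ Icc 0 t, ∀ q, R₁ * Real.exp (τ / n) ≤ support F ν τ q := fun τ hτ q =>
    h.le_support hn hR₁ h₁ (hIco τ hτ) q
  have hwpos : ∀ τ ∈ Icc 0 t, ∀ q, 0 < support F ν τ q := fun τ hτ q =>
    h.support_pos hw0 (hIco τ hτ) q
  have hρ : ∀ τ ∈ Icc 0 t, ∀ q, halfNormSq F τ q ≤ R₂ ^ 2 / 2 * Real.exp (2 * τ / n) :=
    fun τ hτ q => h.halfNormSq_le hn hw0 (h.halfNormSq_zero_le hT.le hw0 h₂) (hIco τ hτ) q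
  have hρ0 : ∀ τ q, 0 ≤ halfNormSq F τ q := fun τ q =>
    div_nonneg real_inner_self_nonneg zero_le_two
  set K := R₂ / R₁ with hK
  have hKpos : 0 < K := div_pos hR₂ hR₁
  -- The factor balances two demands: λρ ≤ R₁e^{τ/n}/2 ≤ w/2, and λw ≥ (R₁/R₂)² uniformly in time.
  set lam : ℝ → ℝ := fun τ => R₁ / R₂ ^ 2 * Real.exp (-(1 / n * τ)) with hlam
  have hlampos : ∀ τ, 0 < lam τ := fun τ => by simp only [hlam]; positivity
  have hlamρ : ∀ τ ∈ Icc 0 t, ∀ q, lam τ * halfNormSq F τ q ≤ support F ν τ q / 2 := by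
    intro τ hτ q
    have h3 := mul_le_mul_of_nonneg_left (hρ τ hτ q) (hlampos τ).le
    have h4 : lam τ * (R₂ ^ 2 / 2 * Real.exp (2 * τ / n)) = R₁ * Real.exp (τ / n) / 2 := by
      have h5 : Real.exp (2 * τ / n) = Real.exp (1 / n * τ) * Real.exp (τ / n) := by
        rw [← Real.exp_add]; congr 1; ring
      simp only [hlam]
      rw [Real.exp_neg, h5]
      field_simp
    linarith [hw τ hτ q]
  set f : ℝ → M → ℝ := fun τ q => support F ν τ q - lam τ * halfNormSq F τ q with hf
  have hfw : ∀ τ ∈ Icc 0 t, ∀ q, support F ν τ q ≤ 2 * f τ q := fun τ hτ q => by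
    simp only [hf]; linarith [hlamρ τ hτ q]
  have hfpos : ∀ τ ∈ Icc 0 t, ∀ q, 0 < f τ q := fun τ hτ q => by
    linarith [hfw τ hτ q, hwpos τ hτ q]
  have hden : ∀ τ ∈ Icc 0 t, ∀ q, 0 < (8 * Real.sqrt τ + 2 * K) * f τ q := fun τ hτ q =>
    mul_pos (by positivity) (hfpos τ hτ q)
  suffices hmain : speed F ν t p ≤ (8 + 2 * K * (Real.sqrt t)⁻¹) * f t p by
    have htI : t ∈ Icc 0 t := right_mem_Icc.2 ht.1.le
    refine hmain.trans (mul_le_mul_of_nonneg_left ?_ (by positivity))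
    have h3 : support F ν t p ≤ R₂ * Real.exp (t / n) := by
      refine abs_le_of_sq_le_sq' ?_ (by positivity) |>.2
      have h4 := h.support_sq_le (hIcc t htI) p
      have h5 : (R₂ * Real.exp (t / n)) ^ 2 = 2 * (R₂ ^ 2 / 2 * Real.exp (2 * t / n)) := by
        rw [mul_pow, ← Real.exp_nat_mul]
        push_cast
        rw [mul_div_assoc]
        ring
      rw [h5]
      linarith [hρ t htI p]
    simp only [hf]
    linarith [mul_nonneg (hlampos t).le (hρ0 t p)]
  -- The quotient u/(Yf) is maximised after multiplying numerator and denominator by √τ. This makes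
  -- it continuous on the closed interval and zero at τ = 0, so a value above 1 forces t₀ > 0.
  obtain ⟨p₀, t₀, ht₀, hmin⟩ := exists_min ht.1.le
    (f := fun q : M × ℝ => -(Real.sqrt q.2 * speed F ν q.2 q.1 /
      ((8 * Real.sqrt q.2 + 2 * K) * f q.2 q.1)))
    (ContinuousOn.neg (ContinuousOn.div
      ((by fun_prop : ContinuousOn (fun q : M × ℝ => Real.sqrt q.2) _).mul
        ((h.continuousOn_speed hT).mono hsub))
      ((by fun_prop : ContinuousOn (fun q : M × ℝ => 8 * Real.sqrt q.2 + 2 * K) _).mul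
        ((h.continuousOn_support.mono hsub).sub ((by fun_prop : ContinuousOn
          (fun q : M × ℝ => lam q.2) _).mul (h.continuousOn_halfNormSq.mono hsub))))
      fun q hq => (hden _ hq.2 _).ne'))
  set m := Real.sqrt t₀ * speed F ν t₀ p₀ / ((8 * Real.sqrt t₀ + 2 * K) * f t₀ p₀) with hm
  have hup : ∀ τ ∈ Ioc 0 t, ∀ q,
      speed F ν τ q ≤ m * ((8 + 2 * K * (Real.sqrt τ)⁻¹) * f τ q) := by
    intro τ hτ q
    have h3 := neg_le_neg_iff.1 (hmin q τ ⟨hτ.1.le, hτ.2⟩)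
    simp only at h3
    rw [div_le_iff₀ (hden τ ⟨hτ.1.le, hτ.2⟩ q)] at h3
    have hs := Real.sqrt_pos.2 hτ.1
    have h4 : m * ((8 + 2 * K * (Real.sqrt τ)⁻¹) * f τ q) * Real.sqrt τ =
        m * ((8 * Real.sqrt τ + 2 * K) * f τ q) := by field_simp
    refine le_of_mul_le_mul_right ?_ hs
    rw [h4, mul_comm]
    exact h3
  suffices hm1 : m ≤ 1 by
    refine (hup t ⟨ht.1, le_rfl⟩ p).trans (mul_le_of_le_one_left ?_ hm1)
    exact mul_nonneg (by positivity) (hfpos t (right_mem_Icc.2 ht.1.le) p).le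
  by_contra! hm1
  have ht₀pos : 0 < t₀ := by
    rcases ht₀.1.eq_or_lt with h3 | h3
    · rw [hm, ← h3] at hm1
      norm_num at hm1
    · exact h3
  have hs := Real.sqrt_pos.2 ht₀pos
  set s := Real.sqrt t₀ with hsdef
  set Y : ℝ → ℝ := fun τ => 8 + 2 * K * (Real.sqrt τ)⁻¹ with hY
  have hYd : HasDerivAt Y (-(K / s ^ 3)) t₀ := by
    have h3 := (((Real.hasDerivAt_sqrt ht₀pos.ne').fun_inv hs.ne').const_mul (2 * K)).const_add 8
    refine h3.congr_deriv ?_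
    rw [← hsdef]
    field_simp
  have hlamd : HasDerivAt lam (-(1 / n * lam t₀)) t₀ := by
    have h3 := ((((hasDerivAt_id t₀).const_mul (1 / (n : ℝ))).fun_neg).exp).const_mul (R₁ / R₂ ^ 2)
    refine h3.congr_deriv ?_
    simp only [hlam, id]
    ring
  have heq : speed F ν t₀ p₀ = m * (Y t₀ * f t₀ p₀) := by
    simp only [hm, hY, ← hsdef]
    have h3 := (hfpos t₀ ht₀ p₀).ne'
    have h4 : 8 * s + 2 * K ≠ 0 := by positivity
    field_simp
  obtain ⟨B, hB1, hB⟩ := h.touching_inequality ⟨ht₀pos, ht₀.2.trans_lt ht.2⟩ p₀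
    (a := fun _ => 1) (b := fun τ => -(m * Y τ)) (c := fun τ => m * (Y τ * lam τ))
    (d := fun _ => 0)
    (hasDerivAt_const _ _) ((hYd.const_mul m).fun_neg) ((hYd.fun_mul hlamd).const_mul m)
    (hasDerivAt_const _ _)
    (fun τ hτ q => by
      have h3 := hup τ ⟨hτ.1, hτ.2.trans ht₀.2⟩ q
      simp only [hf] at h3
      simp only [hY]
      linarith)
    (by
      simp only [hf] at heq
      linarith)
  have hf0 := hfpos t₀ ht₀ p₀
  have hfw0 := hfw t₀ ht₀ p₀
  have hfdef : f t₀ p₀ = support F ν t₀ p₀ - lam t₀ * halfNormSq F t₀ p₀ := rfl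
  have hlw : 1 ≤ 2 * K ^ 2 * (lam t₀ * f t₀ p₀) := by
    have h3 : lam t₀ * (R₁ * Real.exp (t₀ / n)) = (K ^ 2)⁻¹ := by
      simp only [hlam, hK]
      rw [Real.exp_neg, show t₀ / (n : ℝ) = 1 / n * t₀ by ring]
      field_simp
    have h4 := mul_le_mul_of_nonneg_left (hw t₀ ht₀ p₀) (hlampos t₀).le
    have h5 := mul_le_mul_of_nonneg_left hfw0 (hlampos t₀).le
    rw [h3] at h4
    have h6 := mul_le_mul_of_nonneg_left (h4.trans h5) (sq_nonneg K)
    rw [mul_inv_cancel₀ (by positivity)] at h6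
    linarith
  have hY0 : Y t₀ = 8 + 2 * K * s⁻¹ := rfl
  exact not_touching hn1 hB1 hm1 hs hKpos hf0 (hlampos t₀) (hρ0 t₀ p₀) hfdef hfw0 hlw hY0 heq hB

end IsSolution

end Estimate

end IMCF

/-! ### The estimate up to the final time -/

theorem mainTheorem4 (n : ℕ) (hn : 1 ≤ n) :
    ∃ C : ℝ, 0 < C ∧
      ∀ (M : Type*) [TopologicalSpace M] [T2Space M] [CompactSpace M]
        [ChartedSpace (EuclideanSpace ℝ (Fin n)) M] [IsManifold (𝓡 n) ∞ M]
        (T : ℝ) (F ν : ℝ → M → EuclideanSpace ℝ (Fin (n + 1))),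
        IMCF.IsSolution T F ν →
        ∀ R₁ R₂ : ℝ, 0 < R₁ →
        (∀ p : M, R₁ ≤ inner ℝ (F 0 p) (ν 0 p) ∧ inner ℝ (F 0 p) (ν 0 p) ≤ R₂) →
        ∀ t ∈ Ioc 0 T, ∀ p : M,
          1 / IMCF.meanCurvature (F t) (ν t) p ≤
            C * (R₂ / R₁) * (1 + 1 / Real.sqrt t) * R₂ * Real.exp (t / n) := by
  -- As R₂/R₁ ≥ 1, the constant 8 absorbs both terms of 8 + 2(R₂/R₁)t^{−1/2}; it does not even
  -- depend on n.
  refine ⟨8, by norm_num, ?_⟩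
  intro M _ _ _ _ _ T F ν h R₁ R₂ hR₁ h0 t ht p
  have hT : 0 < T := ht.1.trans_le ht.2
  have hR₂ : R₁ ≤ R₂ := (h0 p).1.trans (h0 p).2
  have hR₂pos : 0 < R₂ := hR₁.trans_le hR₂
  have hK : 1 ≤ R₂ / R₁ := (one_le_div hR₁).2 hR₂
  have key : IMCF.speed F ν t p ≤
      (8 + 2 * (R₂ / R₁) * (Real.sqrt t)⁻¹) * (R₂ * Real.exp (t / n)) := by
    have hlt := fun τ (hτ : τ ∈ Ioo 0 T) =>
      h.speed_le_of_lt hn hR₁ (fun q => (h0 q).1) (fun q => (h0 q).2) hτ p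
    rcases ht.2.lt_or_eq with h1 | rfl
    · exact hlt t ⟨ht.1, h1⟩
    -- The maximum principle was run at interior times only; the final time follows by continuity of
    -- both sides.
    · have h2 : ContinuousWithinAt (fun τ => IMCF.speed F ν τ p) (Ioo 0 t) t := by
        have h3 : ContinuousOn (fun τ : ℝ => ((p, τ) : M × ℝ)) (Icc 0 t) := by fun_prop
        exact (((h.continuousOn_speed hT).comp h3 fun τ hτ => ⟨mem_univ _, hτ⟩) t
          (right_mem_Icc.2 hT.le)).mono Ioo_subset_Icc_self
      have h4 : ContinuousWithinAt (fun τ => (8 + 2 * (R₂ / R₁) * (Real.sqrt τ)⁻¹) *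
          (R₂ * Real.exp (τ / n))) (Ioo 0 t) t := by
        refine ContinuousAt.continuousWithinAt ?_
        have h5 : ContinuousAt (fun τ => (Real.sqrt τ)⁻¹) t :=
          Real.continuous_sqrt.continuousAt.inv₀ (Real.sqrt_pos.2 hT).ne'
        fun_prop
      refine ContinuousWithinAt.closure_le (s := Ioo 0 t) ?_ h2 h4 hlt
      rw [closure_Ioo hT.ne]
      exact right_mem_Icc.2 hT.le
  rw [one_div]
  refine le_trans key ?_
  have hs : 0 < (Real.sqrt t)⁻¹ := inv_pos.2 (Real.sqrt_pos.2 ht.1)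
  have h1 : 8 + 2 * (R₂ / R₁) * (Real.sqrt t)⁻¹ ≤ 8 * (R₂ / R₁) * (1 + 1 / Real.sqrt t) := by
    rw [one_div]
    nlinarith [mul_pos (zero_lt_one.trans_le hK) hs]
  calc _ ≤ 8 * (R₂ / R₁) * (1 + 1 / Real.sqrt t) * (R₂ * Real.exp (t / n)) :=
        mul_le_mul_of_nonneg_right h1 (by positivity)
    _ = _ := by ring
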